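/- Let $\mathsf{Seq}$ be the first-order theory (with equality) in the language $\{e,\vdash,\circ\}$, where $e$ is a constant symbol and $\vdash,\circ$ are binary function symbols, with the five axioms \begin{align*} \mathsf{Seq}_1&:\ \forall x y\,[\,x\vdash y\neq e\,],\\ \mathsf{Seq}_2&:\ \forall x_1x_2y_1y_2\,[\,x_1\vdash x_2=y_1\vdash y_2\rightarrow(x_1=y_1\wedge x_2=y_2)\,],\\ \mathsf{Seq}_3&:\ \forall x\,[\,x\circ e=x\,],\\ \mathsf{Seq}_4&:\ \forall xyz\,[\,x\circ(y\vdash z)=(x\circ y)\vdash z\,],\\ \mathsf{Seq}_5&:\ \forall x\,[\,x=e\vee\exists yz\,[x=y\vdash z]\,]. \end{align*} Let $\mathsf{Seq}^+$ be the extension of $\mathsf{Seq}$ by the axioms \begin{align*} \mathsf{Seq}^*_3&:\ \forall x\,[\,x\circ e=x\wedge e\circ x=x\,],\\ \mathsf{Seq}^*_5&:\ \forall xyzw\,[\,x\circ y=z\circ w\leftrightarrow\exists u\,[(z=x\circ u\wedge u\circ w=y)\vee(x=z\circ u\wedge u\circ y=w)]\,],\\ \mathsf{Seq}^+_c&:\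 \forall xyz\,[\,(x\circ y=x\circ z\vee y\circ x=z\circ x)\rightarrow y=z\,]. \end{align*} Let $\mathsf{AST+EXT}$ be the first-order theory (with equality) in the language $\{\in\}$ with the axioms \begin{align*} &\exists y\forall x\,[\,x\notin y\,] &&\text{(empty set)},\\ &\forall xy\,\exists z\,\forall u\,[\,u\in z\leftrightarrow(u\in x\vee u=y)\,] &&\text{(adjunction)},\\ &\forall xy\,[\,\forall z\,[z\in x\leftrightarrow z\in y]\rightarrow x=y\,] &&\text{(extensionality)}. \end{align*} A theory $T$ in a relational language $L$ is \emph{interpretable} in a theory $U$ in a language $L'$ if there are an $L'$-formula $\delta(x)$ (the domain) and, for each $n$-ary relation symbol $R$ of $L$, an $L'$-formula $\rho_R(x_1,\dots,x_n)$, with no free variables other than those displayed, such that $U\vdash\exists x\,\delta(x)$ and $U\vdash\varphi^\tau$ for every axiom $\varphi$ of $T$. Here $\varphi^\tau$ is obtained from $\varphi$ by replacing each atomic formula $R(x_1,\dots,x_n)$ by $\rho_R(x_1,\dots,x_n)$, leaving equations unchanged, and relativizing all quantifiers to $\delta$; $U\vdash\psi$ means that $\psi$ is a logical consequence of $U$ (equivalently,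 is provable from $U$). \textbf{Theorem.} $\mathsf{AST+EXT}$ is interpretable in $\mathsf{Seq}^+$, and thus also in $\mathsf{Seq}$. -/

import Mathlib

open FirstOrder FirstOrder.Language

universe u v u' v'

namespace SeqInterp

/-! ### Relative interpretations -/

/-- In a relational language every term is a variable; `varOf t` is that variable. -/
def varOf {L : FirstOrder.Language.{u, v}} [L.IsRelational] {γ : Type} : L.Term γ → γ
  | .var x => x
  | .func f _ => isEmptyElim f

/-- A translation of a relational language `L` into a language `L'` (one-dimensional,
without parameters, equality being translated as equality): a formula with one free variable
defining the domain, and for every `n`-ary relation symbol of `L` a formula of `L'` with the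
`n` free variables `0, …, n - 1`. -/
structure Translation (L : FirstOrder.Language.{u, v}) (L' : FirstOrder.Language.{u', v'}) where
  dom : L'.Formula (Fin 1)
  rel : ∀ {n : ℕ}, L.Relations n → L'.Formula (Fin n)

namespace Translation

variable {L : FirstOrder.Language.{u, v}} {L' : FirstOrder.Language.{u', v'}}

/-- `τ.domAt x` says that the variable `x` (free or bound) lies in the domain. -/
def domAt (τ : Translation L L') {α : Type} {n : ℕ} (x : α ⊕ Fin n) :
    L'.BoundedFormula α n :=
  BoundedFormula.relabel (k := 0) (fun _ : Fin 1 => x) τ.dom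

/-- The translation `φ ↦ φ^τ`. It replaces relation symbols by their defining formulas, commutes
with the connectives, and relativizes quantifiers to the domain. (In Mathlib `∃ x, φ` is
`¬ ∀ x, ¬ φ`, so its translation is equivalent to `∃ x, dom x ∧ φ^τ`.) -/
def formula [L.IsRelational] (τ : Translation L L') {α : Type} :
    ∀ {n : ℕ}, L.BoundedFormula α n → L'.BoundedFormula α n
  | _, .falsum => .falsum
  | _, .equal t₁ t₂ => .equal (.var (varOf t₁)) (.var (varOf t₂))
  | _, .rel R ts => BoundedFormula.relabel (k := 0) (fun i => varOf (ts i)) (τ.rel R)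
  | _, .imp φ ψ => .imp (τ.formula φ) (τ.formula ψ)
  | n, .all φ => .all (.imp (τ.domAt (.inr (Fin.last n))) (τ.formula φ))

end Translation

/-- `Interpretable T U`: the theory `T` is interpretable in the theory `U`, i.e. there is a
translation `τ` such that `U` entails that the domain is non-empty and `U` entails `φ^τ` for
every axiom `φ` of `T`. -/
def Interpretable {L : FirstOrder.Language.{u, v}} [L.IsRelational] {L' : FirstOrder.Language.{u', v'}}
    (T : L.Theory) (U : L'.Theory) : Prop :=
  ∃ τ : Translation L L',
    U ⊨ᵇ (∃' τ.domAt (.inr 0) : L'.Sentence) ∧ ∀ φ ∈ T, U ⊨ᵇ τ.formula φ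

/-! ### The theories of sequences -/

/-- The function symbols: the empty sequence `e`, the operation `⊢` that appends an element to a
sequence, and concatenation `∘`. -/
inductive SeqFunc : ℕ → Type
  | e : SeqFunc 0
  | app : SeqFunc 2
  | conc : SeqFunc 2

/-- The language `{e, ⊢, ∘}`. -/
def seqLang : FirstOrder.Language.{0, 0} := ⟨SeqFunc, fun _ => Empty⟩

/-- The constant `e`. -/
def empt {γ : Type} : seqLang.Term γ := Constants.term (L := seqLang) SeqFunc.e

/-- The term `s ⊢ t`. -/
def app {γ : Type} (s t : seqLang.Term γ) : seqLang.Term γ :=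
  Functions.apply₂ (L := seqLang) SeqFunc.app s t

/-- The term `s ∘ t`. -/
def conc {γ : Type} (s t : seqLang.Term γ) : seqLang.Term γ :=
  Functions.apply₂ (L := seqLang) SeqFunc.conc s t

/-- `∀ x y, x ⊢ y ≠ e`. -/
def seq1 : seqLang.Sentence :=
  ∀' ∀' ∼(app (&0) (&1) =' empt)

/-- `∀ x₁ x₂ y₁ y₂, x₁ ⊢ x₂ = y₁ ⊢ y₂ → x₁ = y₁ ∧ x₂ = y₂`. -/
def seq2 : seqLang.Sentence :=
  ∀' ∀' ∀' ∀' ((app (&0) (&1) =' app (&2) (&3)) ⟹ ((&0 =' &2) ⊓ (&1 =' &3)))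

/-- `∀ x, x ∘ e = x`. -/
def seq3 : seqLang.Sentence :=
  ∀' (conc (&0) empt =' &0)

/-- `∀ x y z, x ∘ (y ⊢ z) = (x ∘ y) ⊢ z`. -/
def seq4 : seqLang.Sentence :=
  ∀' ∀' ∀' (conc (&0) (app (&1) (&2)) =' app (conc (&0) (&1)) (&2))

/-- `∀ x, x = e ∨ ∃ y z, x = y ⊢ z`. -/
def seq5 : seqLang.Sentence :=
  ∀' ((&0 =' empt) ⊔ ∃' ∃' (&0 =' app (&1) (&2)))

/-- `∀ x, x ∘ e = x ∧ e ∘ x = x`. -/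
def seqStar3 : seqLang.Sentence :=
  ∀' ((conc (&0) empt =' &0) ⊓ (conc empt (&0) =' &0))

/-- `∀ x y z w, x ∘ y = z ∘ w ↔
  ∃ u, (z = x ∘ u ∧ u ∘ w = y) ∨ (x = z ∘ u ∧ u ∘ y = w)`. -/
def seqStar5 : seqLang.Sentence :=
  ∀' ∀' ∀' ∀' ((conc (&0) (&1) =' conc (&2) (&3)) ⇔
    ∃' (((&2 =' conc (&0) (&4)) ⊓ (conc (&4) (&3) =' &1)) ⊔
        ((&0 =' conc (&2) (&4)) ⊓ (conc (&4) (&1) =' &3))))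

/-- `∀ x y z, x ∘ y = x ∘ z ∨ y ∘ x = z ∘ x → y = z`. -/
def seqPlusC : seqLang.Sentence :=
  ∀' ∀' ∀' (((conc (&0) (&1) =' conc (&0) (&2)) ⊔ (conc (&1) (&0) =' conc (&2) (&0))) ⟹
    (&1 =' &2))

/-- The theory `Seq`. -/
def seqTheory : seqLang.Theory := {seq1, seq2, seq3, seq4, seq5}

/-- The theory `Seq⁺`. -/
def seqPlusTheory : seqLang.Theory :=
  {seq1, seq2, seq3, seq4, seq5, seqStar3, seqStar5, seqPlusC}

/-! ### Adjunctive set theory with extensionality -/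

/-- The only relation symbol of set theory. -/
inductive SetRel : ℕ → Type
  | mem : SetRel 2

/-- The language `{∈}`. -/
def setLang : FirstOrder.Language.{0, 0} := ⟨fun _ => Empty, SetRel⟩

instance : setLang.IsRelational := fun _ => (inferInstance : IsEmpty Empty)

/-- The atomic formula `s ∈ t`. -/
def mem {α : Type} {n : ℕ} (s t : setLang.Term (α ⊕ Fin n)) : setLang.BoundedFormula α n :=
  Relations.boundedFormula₂ (L := setLang) SetRel.mem s t

/-- Empty set: `∃ y, ∀ x, x ∉ y`. -/
def ast1 : setLang.Sentence :=
  ∃' ∀' ∼(mem (&1) (&0))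

/-- Adjunction: `∀ x y, ∃ z, ∀ u, u ∈ z ↔ (u ∈ x ∨ u = y)`. -/
def ast2 : setLang.Sentence :=
  ∀' ∀' ∃' ∀' (mem (&3) (&2) ⇔ (mem (&3) (&0) ⊔ (&3 =' &1)))

/-- Extensionality: `∀ x y, (∀ z, z ∈ x ↔ z ∈ y) → x = y`. -/
def ast3 : setLang.Sentence :=
  ∀' ∀' ((∀' (mem (&2) (&0) ⇔ mem (&2) (&1))) ⟹ (&0 =' &1))

/-- The theory `AST + EXT`. -/
def astExtTheory : setLang.Theory := {ast1, ast2, ast3}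

end SeqInterp

/-!
`AST + EXT` is interpreted in `Seq` itself, so that the interpretation in the extension `Seq⁺` comes
for free. The difficulty is that equality is translated as equality: every finite set of elements of
the domain must be represented by exactly one element of the domain. This calls for canonical
representatives, hence for a definable linear order, in arbitrary models of `Seq`, where no induction
is available.

*The cut.* In place of induction, properties `P` with `P e` and `P v → P (v ⊢ c)` are collected, and
one passes to a definable class of sequences on which they hold and which is closed under
concatenation and under suffixes (`SeqAlg.Cut`) or even under all factors (`Core`). The first passage
turns a model of `Seq` into a left cancellative monoid with Riesz refinement in which `e ⊢ c` is an
atom (`SeqMonoid`); all further arguments take place in such a monoid.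

*Letters and words.* Numbers are sequences all of whose entries are `e`; the prefix relation orders
them linearly, and this induces a linear order of the letters `e ⊢ n`. Words are sequences of letters,
ordered lexicographically. Cutting a word at its weak records (the entries that no earlier entry
exceeds) splits it into blocks `k * w`, a letter `k` followed by strictly smaller letters. A set is
represented by a block `k * w`: its elements are the blocks of `w`, and `k` is its rank, the least
letter above all entries of `w`. The word `w` is required to list its blocks in strictly increasing
order, and the same is required of all blocks inside it (`Hereditary`). That every block has this
form is a condition on the factors of the word, so no recursion is needed to define it; and since
`k` exceeds all entries of `w`, a block can be recovered from the word in which it is listed.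

*The axioms.* Extensionality (`IsSet.ext`): two different words differ at a first block, and the
smaller of the two blocks there (the only one, if one of the words stops) occurs in one of the two
sorted words but not in the other.
Adjunction (`exists_adjoin`): a word in the cut has a place where a given block can be inserted
(`HasPlace`), insertion keeps it sorted (`Sorted.insert`), and the rank is adjusted.

*Definability.* All notions above are defined by the same formula in all models; `UDef` expresses
this, and its closure properties replace the writing of formulas. `Translation.realize_formula`
reduces the translated axioms to the axioms in the structure defined by the translation.
-/

namespace SeqInterp

/-! ### Models of `Seq` and their well-behaved cut -/

/-- A model of `Seq`, presented as an algebraic structure: `nil`, `snoc` and `cat` are the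
interpretations of `e`, `⊢` and `∘`. -/
class SeqAlg (M : Type) where
  nil : M
  snoc : M → M → M
  cat : M → M → M
  snoc_ne : ∀ x y, snoc x y ≠ nil
  snoc_inj : ∀ x y z w, snoc x y = snoc z w → x = z ∧ y = w
  cat_nil : ∀ x, cat x nil = x
  cat_snoc : ∀ x y z, cat x (snoc y z) = snoc (cat x y) z
  nil_or_snoc : ∀ x, x = nil ∨ ∃ y z, x = snoc y z

namespace SeqAlg

local infixl:67 " ⋆ " => SeqAlg.cat
local infixl:67 " ◁ " => SeqAlg.snoc

variable {M : Type} [SeqAlg M]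

attribute [simp] cat_nil cat_snoc snoc_ne

@[simp] theorem snoc_inj_iff {x y z w : M} : x ◁ y = z ◁ w ↔ x = z ∧ y = w :=
  ⟨snoc_inj x y z w, by rintro ⟨rfl, rfl⟩; rfl⟩

theorem cat_eq_nil {x y : M} (h : x ⋆ y = nil) : x = nil ∧ y = nil := by
  rcases nil_or_snoc y with rfl | ⟨a, b, rfl⟩
  · simpa using h
  · simp at h

/-- Concatenation is associative if the last factor is `v`, and `nil` is a left unit for `v`. -/
def Regular (v : M) : Prop := (∀ x y : M, x ⋆ (y ⋆ v) = x ⋆ y ⋆ v) ∧ nil ⋆ v = v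

theorem regular_nil : Regular (nil : M) := by simp [Regular]

theorem regular_snoc {v c : M} : Regular (v ◁ c) ↔ Regular v := by simp [Regular]

theorem Regular.cat {x y : M} (hx : Regular x) (hy : Regular y) : Regular (x ⋆ y) := by
  obtain ⟨ax, lx⟩ := hx
  obtain ⟨ay, -⟩ := hy
  refine ⟨fun a b => ?_, ?_⟩
  · rw [ay, ay, ay, ax]
  · rw [ay, lx]

/-- The refinement property of concatenation, for a fixed second factor `y`. -/
def Refining (y : M) : Prop :=
  ∀ x z w : M, x ⋆ y = z ⋆ w →
    ∃ u : M, (z = x ⋆ u ∧ u ⋆ w = y) ∨ (x = z ⋆ u ∧ u ⋆ y = w)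

theorem refining_nil : Refining (nil : M) := fun x z w h =>
  ⟨w, Or.inr ⟨by simpa using h, by simp⟩⟩

theorem Refining.snoc {y : M} (hy : Refining y) (c : M) : Refining (y ◁ c) := by
  intro x z w h
  rcases nil_or_snoc w with rfl | ⟨w, d, rfl⟩
  · exact ⟨y ◁ c, Or.inl ⟨by simpa using h.symm, by simp⟩⟩
  · simp only [cat_snoc, snoc_inj_iff] at h
    obtain ⟨h, rfl⟩ := h
    obtain ⟨u, ⟨rfl, rfl⟩ | ⟨rfl, rfl⟩⟩ := hy x z w h
    · exact ⟨u, Or.inl ⟨rfl, by simp⟩⟩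
    · exact ⟨u, Or.inr ⟨rfl, by simp⟩⟩

/-- `v` is empty or has a first entry. -/
def HasFirst (v : M) : Prop := v = nil ∨ ∃ c t : M, v = nil ◁ c ⋆ t

theorem HasFirst.snoc {v : M} (hv : HasFirst v) (c : M) : HasFirst (v ◁ c) := by
  rcases hv with rfl | ⟨d, t, rfl⟩
  · exact Or.inr ⟨c, nil, by simp⟩
  · exact Or.inr ⟨d, t ◁ c, by simp⟩

/-- `x` is not a proper prefix of itself. -/
def Acyclic (x : M) : Prop := ∀ t : M, Regular t → x ⋆ t = x → t = nil

theorem acyclic_nil : Acyclic (nil : M) := fun _ _ h => (cat_eq_nil h).2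

theorem Acyclic.snoc {x : M} (hx : Acyclic x) (c : M) : Acyclic (x ◁ c) := by
  intro t ht h
  rcases nil_or_snoc t with rfl | ⟨t, d, rfl⟩
  · rfl
  · rw [regular_snoc] at ht
    simp only [cat_snoc, snoc_inj_iff] at h
    have e : x ⋆ (nil ◁ c ⋆ t) = x := by
      rw [ht.1]
      simpa using h.1
    have := cat_eq_nil (hx _ ((regular_snoc.2 regular_nil).cat ht) e)
    simp at this

/-- The conjunction of the inductive properties from which the cut is built. -/
def Tame (v : M) : Prop := Regular v ∧ Refining v ∧ HasFirst v ∧ Acyclic v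

theorem tame_nil : Tame (nil : M) := ⟨regular_nil, refining_nil, Or.inl rfl, acyclic_nil⟩

theorem Tame.snoc {v : M} (hv : Tame v) (c : M) : Tame (v ◁ c) :=
  ⟨regular_snoc.2 hv.1, hv.2.1.snoc c, hv.2.2.1.snoc c, hv.2.2.2.snoc c⟩

/-- `v` is tame and so is every product of a tame element with `v`; this makes the class closed
under concatenation. -/
def Absorbed (v : M) : Prop := Tame v ∧ ∀ u : M, Tame u → Tame (u ⋆ v)

theorem absorbed_nil : Absorbed (nil : M) := ⟨tame_nil, fun u hu => by simpa using hu⟩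

theorem Absorbed.snoc {v : M} (hv : Absorbed v) (c : M) : Absorbed (v ◁ c) :=
  ⟨hv.1.snoc c, fun u hu => by simpa using (hv.2 u hu).snoc c⟩

theorem Absorbed.cat {v w : M} (hv : Absorbed v) (hw : Absorbed w) : Absorbed (v ⋆ w) :=
  ⟨hw.2 _ hv.1, fun u hu => by
    rw [hw.1.1.1]
    exact hw.2 _ (hv.2 u hu)⟩

/-- The cut: `v` and all its suffixes are absorbed. A suffix `f` is taken in the form
`x ∘ (a ∘ f)`, with one factor more than expected: concatenation is not associative outside the
cut, and the additional factor is what makes the class closed under suffixes. -/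
def Cut (v : M) : Prop := Absorbed v ∧ ∀ x a f : M, v = x ⋆ (a ⋆ f) → Absorbed f

theorem Cut.nil_cat {v : M} (hv : Cut v) : nil ⋆ v = v := hv.1.1.1.2

theorem Cut.right {x y : M} (h : Cut (x ⋆ y)) : Cut y := by
  refine ⟨h.2 nil x y h.nil_cat.symm, fun x' a f e => ?_⟩
  have h1 : Absorbed (a ⋆ f) := h.2 x x' _ (by rw [e])
  exact h.2 (x ⋆ x') a f (by rw [e, h1.1.1.1])

theorem cut_nil : Cut (nil : M) := by
  refine ⟨absorbed_nil, fun x a f e => ?_⟩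
  rw [(cat_eq_nil (cat_eq_nil e.symm).2).2]
  exact absorbed_nil

theorem Cut.snoc {v : M} (hv : Cut v) (c : M) : Cut (v ◁ c) := by
  refine ⟨hv.1.snoc c, fun x a f e => ?_⟩
  rcases nil_or_snoc f with rfl | ⟨f, d, rfl⟩
  · exact absorbed_nil
  · simp only [cat_snoc, snoc_inj_iff] at e
    exact (hv.2 x a f e.1).snoc d

theorem Cut.cat {v w : M} (hv : Cut v) (hw : Cut w) : Cut (v ⋆ w) := by
  have ref : ∀ {x z t : M}, x ⋆ w = z ⋆ t →
      ∃ u : M, (z = x ⋆ u ∧ u ⋆ t = w) ∨ (x = z ⋆ u ∧ u ⋆ w = t) := fun h => hw.1.1.2.1 _ _ _ h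
  refine ⟨hv.1.cat hw.1, fun x a f e => ?_⟩
  obtain ⟨u, ⟨-, h⟩ | ⟨h1, h⟩⟩ := ref e
  · exact hw.2 u a f h.symm
  obtain ⟨u', ⟨-, h'⟩ | ⟨h2, h'⟩⟩ := ref h
  · exact hw.2 nil u' f (by rw [h', hw.nil_cat])
  · rw [← h']
    exact Absorbed.cat (hv.2 x a u' (by rw [← h2, ← h1])) hw.1

end SeqAlg

/-! ### Monoids of sequences -/

/-- An irreducible element of a monoid of sequences: a sequence of length one. -/
def Atom {W : Type} [Monoid W] (a : W) : Prop := a ≠ 1 ∧ ∀ x y : W, a = x * y → x = 1 ∨ y = 1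

/-- A left cancellative monoid with the refinement property in which every non-unit starts with an
atom, with an injection `sing` of all elements into the atoms; `sing w` is the sequence whose only
entry is `w`. -/
class SeqMonoid (W : Type) extends Monoid W where
  sing : W → W
  sing_inj : ∀ x y, sing x = sing y → x = y
  sing_atom : ∀ x, Atom (sing x)
  left_cancel : ∀ x y z : W, x * y = x * z → y = z
  refinement : ∀ x y z w : W, x * y = z * w →
    ∃ u, (z = x * u ∧ u * w = y) ∨ (x = z * u ∧ u * y = w)
  eq_one_left : ∀ x y : W, x * y = 1 → x = 1
  first : ∀ v : W, v = 1 ∨ ∃ a t, Atom a ∧ v = a * t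

/-- The cut of a model of `Seq`, as a type. -/
abbrev CutType (M : Type) [SeqAlg M] : Type := {v : M // SeqAlg.Cut v}

instance (M : Type) [SeqAlg M] : Monoid (CutType M) where
  mul x y := ⟨SeqAlg.cat x.1 y.1, x.2.cat y.2⟩
  one := ⟨SeqAlg.nil, SeqAlg.cut_nil⟩
  mul_assoc _ _ z := Subtype.ext (z.2.1.1.1.1 _ _).symm
  one_mul x := Subtype.ext x.2.nil_cat
  mul_one _ := Subtype.ext (SeqAlg.cat_nil _)

theorem CutType.atom_sing {M : Type} [SeqAlg M] (c : M) :
    Atom (⟨SeqAlg.snoc SeqAlg.nil c, SeqAlg.cut_nil.snoc c⟩ : CutType M) := by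
  refine ⟨fun h => SeqAlg.snoc_ne _ _ (Subtype.ext_iff.1 h), fun x y h => ?_⟩
  replace h : SeqAlg.snoc SeqAlg.nil c = SeqAlg.cat x.1 y.1 := Subtype.ext_iff.1 h
  rcases SeqAlg.nil_or_snoc y.1 with hy | ⟨t, d, hy⟩
  · exact Or.inr (Subtype.ext hy)
  · rw [hy, SeqAlg.cat_snoc, SeqAlg.snoc_inj_iff] at h
    exact Or.inl (Subtype.ext (SeqAlg.cat_eq_nil h.1.symm).1)

instance (M : Type) [SeqAlg M] : SeqMonoid (CutType M) where
  sing x := ⟨SeqAlg.snoc SeqAlg.nil x.1, SeqAlg.cut_nil.snoc _⟩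
  sing_inj x y h := Subtype.ext (SeqAlg.snoc_inj_iff.1 (Subtype.ext_iff.1 h)).2
  sing_atom x := CutType.atom_sing x.1
  left_cancel x y z h := by
    have h' : SeqAlg.cat x.1 y.1 = SeqAlg.cat x.1 z.1 := Subtype.ext_iff.1 h
    obtain ⟨u, hu⟩ := y.2.1.1.2.1 _ _ _ h'
    have hx : x.1 = SeqAlg.cat x.1 u := by rcases hu with ⟨h, -⟩ | ⟨h, -⟩ <;> exact h
    have cu : SeqAlg.Cut u := SeqAlg.Cut.right (hx ▸ x.2)
    have u1 : u = SeqAlg.nil := x.2.1.1.2.2.2 u cu.1.1.1 hx.symm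
    subst u1
    rcases hu with ⟨-, h⟩ | ⟨-, h⟩
    · exact Subtype.ext (by rw [← h, z.2.nil_cat])
    · exact Subtype.ext (by rw [← h, y.2.nil_cat])
  refinement x y z w h := by
    have h' : SeqAlg.cat x.1 y.1 = SeqAlg.cat z.1 w.1 := Subtype.ext_iff.1 h
    obtain ⟨u, ⟨h1, h2⟩ | ⟨h1, h2⟩⟩ := y.2.1.1.2.1 _ _ _ h'
    · have cu : SeqAlg.Cut u := SeqAlg.Cut.right (h1 ▸ z.2)
      exact ⟨⟨u, cu⟩, Or.inl ⟨Subtype.ext h1, Subtype.ext h2⟩⟩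
    · have cu : SeqAlg.Cut u := SeqAlg.Cut.right (h1 ▸ x.2)
      exact ⟨⟨u, cu⟩, Or.inr ⟨Subtype.ext h1, Subtype.ext h2⟩⟩
  eq_one_left x y h := Subtype.ext (SeqAlg.cat_eq_nil (Subtype.ext_iff.1 h)).1
  first v := by
    rcases v.2.1.1.2.2.1 with h | ⟨c, t, h⟩
    · exact Or.inl (Subtype.ext h)
    · have ct : SeqAlg.Cut t := SeqAlg.Cut.right (h ▸ v.2)
      exact Or.inr ⟨_, ⟨t, ct⟩, CutType.atom_sing c, Subtype.ext h⟩

/-! ### Occurrences of atoms, and shortening of cuts -/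

section Words

variable {W : Type} [SeqMonoid W]

open SeqMonoid

theorem eq_one_right {x y : W} (h : x * y = 1) : y = 1 := by
  have := eq_one_left x y h
  rwa [this, one_mul] at h

theorem mul_ne_one_left {x : W} (y : W) (h : x ≠ 1) : x * y ≠ 1 := fun e => h (eq_one_left _ _ e)

theorem mul_right_eq_self {x y : W} (h : x = x * y) : y = 1 :=
  (left_cancel x 1 y (by rwa [mul_one])).symm

theorem atom_mul_inj {a b x y : W} (ha : Atom a) (hb : Atom b) (h : a * x = b * y) :
    a = b ∧ x = y := by
  have key : a = b := by
    obtain ⟨u, ⟨h1, -⟩ | ⟨h1, -⟩⟩ := SeqMonoid.refinement _ _ _ _ h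
    · rcases hb.2 _ _ h1 with h2 | h2
      · exact absurd h2 ha.1
      · rw [h1, h2, mul_one]
    · rcases ha.2 _ _ h1 with h2 | h2
      · exact absurd h2 hb.1
      · rw [h1, h2, mul_one]
  subst key
  exact ⟨rfl, left_cancel _ _ _ h⟩

/-- An infix of a product lies in one factor or is a suffix of the first times a prefix of the
second. -/
theorem mul_factor {v w x f y : W} (h : v * w = x * f * y) :
    (∃ z, v = x * f * z) ∨ (∃ z, w = z * f * y) ∨
      ∃ g k, f = g * k ∧ v = x * g ∧ w = k * y := by
  obtain ⟨u, ⟨h1, h2⟩ | ⟨h1, -⟩⟩ := SeqMonoid.refinement _ _ _ _ h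
  · obtain ⟨g, ⟨h3, h4⟩ | ⟨h3, h4⟩⟩ := SeqMonoid.refinement _ _ _ _ h1
    · exact Or.inr (Or.inr ⟨g, u, h4.symm, h3, h2.symm⟩)
    · exact Or.inr (Or.inl ⟨g, by rw [← h2, ← h4]⟩)
  · exact Or.inl ⟨u, h1⟩

/-- The atom `a` is an entry of `v`. -/
def Occ (a v : W) : Prop := Atom a ∧ ∃ p q, v = p * a * q

theorem occ_one {a : W} : ¬ Occ a (1 : W) := by
  rintro ⟨h, p, q, e⟩
  exact h.1 (eq_one_right (eq_one_left _ _ e.symm))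

theorem occ_mul {a x y : W} : Occ a (x * y) ↔ Occ a x ∨ Occ a y := by
  constructor
  · rintro ⟨h, p, q, e⟩
    rcases mul_factor e with ⟨z, hz⟩ | ⟨z, hz⟩ | ⟨g, k, h1, h2, h3⟩
    · exact Or.inl ⟨h, _, _, hz⟩
    · exact Or.inr ⟨h, _, _, hz⟩
    · rcases h.2 _ _ h1 with rfl | rfl
      · rw [one_mul] at h1
        exact Or.inr ⟨h, 1, q, by rw [h3, h1, one_mul]⟩
      · rw [mul_one] at h1
        exact Or.inl ⟨h, p, 1, by rw [h2, h1, mul_one]⟩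
  · rintro (⟨h, p, q, e⟩ | ⟨h, p, q, e⟩)
    · exact ⟨h, p, q * y, by rw [e, mul_assoc]⟩
    · exact ⟨h, x * p, q, by rw [e]; simp only [mul_assoc]⟩

theorem occ_atom {a b : W} (hb : Atom b) : Occ a b ↔ a = b := by
  constructor
  · rintro ⟨h, p, q, e⟩
    rcases hb.2 _ _ e with h1 | rfl
    · exact absurd (eq_one_right h1) h.1
    · rw [mul_one] at e
      rcases hb.2 _ _ e with rfl | h1
      · rw [e, one_mul]
      · exact absurd h1 h.1
  · rintro rfl
    exact ⟨hb, 1, 1, by simp⟩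

/-- Shortening of a cut: if `P` holds at `1` and is preserved by appending atoms of some kind, then
`Core P` is a subclass of `P` that contains these atoms and is closed under products and infixes. -/
def Core (P : W → Prop) (v : W) : Prop :=
  ∀ x f y : W, v = x * f * y → ∀ u, P u → P (u * f)

section Core

variable {P : W → Prop}

theorem Core.spec {v : W} (h : Core P v) (h1 : P 1) : P v := by
  simpa using h 1 v 1 (by simp) 1 h1

theorem Core.of_infix {v x f y : W} (h : Core P v) (e : v = x * f * y) : Core P f := by
  intro x' f' y' e'
  refine h (x * x') f' (y' * y) ?_
  rw [e, e']
  simp only [mul_assoc]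

theorem Core.left {x y : W} (h : Core P (x * y)) : Core P x :=
  h.of_infix (x := 1) (y := y) (by simp)

theorem Core.right {x y : W} (h : Core P (x * y)) : Core P y :=
  h.of_infix (x := x) (y := 1) (by simp)

theorem core_one : Core P (1 : W) := by
  intro x f y e u hu
  rwa [eq_one_right (eq_one_left _ _ e.symm), mul_one]

theorem Core.mul {v w : W} (hv : Core P v) (hw : Core P w) : Core P (v * w) := by
  intro x f y e u hu
  rcases mul_factor e with ⟨z, hz⟩ | ⟨z, hz⟩ | ⟨g, k, rfl, h2, h3⟩
  · exact hv _ _ _ hz u hu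
  · exact hw _ _ _ hz u hu
  · rw [← mul_assoc]
    exact hw 1 k y (by rw [h3, one_mul]) _ (hv x g 1 (by rw [h2, mul_one]) u hu)

theorem core_atom {a : W} (ha : Atom a) (hP : ∀ v, P v → P (v * a)) : Core P a := by
  intro x f y e u hu
  rcases ha.2 _ _ e with h | rfl
  · rwa [eq_one_right h, mul_one]
  · rw [mul_one] at e
    rcases ha.2 _ _ e with rfl | rfl
    · rw [one_mul] at e
      exact e ▸ hP u hu
    · rwa [mul_one]

end Core

/-! ### Comparison of sequences, numbers and letters -/

/-- `u` can be compared with every sequence: one is a prefix of the other, or there is a first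
place where they differ. -/
def Comparable (u : W) : Prop :=
  ∀ v, (∃ t, v = u * t) ∨ (∃ t, u = v * t) ∨
    ∃ p a b s t, Atom a ∧ Atom b ∧ a ≠ b ∧ u = p * a * s ∧ v = p * b * t

theorem comparable_one : Comparable (1 : W) := fun v => Or.inl ⟨v, by simp⟩

theorem Comparable.mul_atom {u c : W} (hu : Comparable u) (hc : Atom c) :
    Comparable (u * c) := by
  intro v
  rcases hu v with ⟨t, rfl⟩ | ⟨t, rfl⟩ | ⟨p, a, b, s, t, ha, hb, hab, rfl, rfl⟩
  · rcases first t with rfl | ⟨d, t, hd, rfl⟩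
    · exact Or.inr (Or.inl ⟨c, by simp⟩)
    · by_cases h : c = d
      · subst h
        exact Or.inl ⟨t, by simp only [mul_assoc]⟩
      · exact Or.inr (Or.inr ⟨u, c, d, 1, t, hc, hd, h, by simp, by simp only [mul_assoc]⟩)
  · exact Or.inr (Or.inl ⟨t * c, by simp only [mul_assoc]⟩)
  · exact Or.inr (Or.inr ⟨p, a, b, s * c, t, ha, hb, hab, by simp only [mul_assoc], rfl⟩)

/-- The cut of sequences that can be compared with all others. -/
def Lin (v : W) : Prop := Core Comparable v

theorem lin_atom {a : W} (ha : Atom a) : Lin a := core_atom ha fun _ hv => hv.mul_atom ha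

theorem Lin.comparable {v : W} (hv : Lin v) : Comparable v := Core.spec hv comparable_one

/-- Numbers are the sequences all of whose entries are `e`; the number `n` is a sequence of
length `n`, and the successor of `n` is `n * sing 1`. -/
def Num (n : W) : Prop := Lin n ∧ ∀ a, Occ a n → a = sing 1

theorem num_one : Num (1 : W) := ⟨core_one, fun _ h => absurd h occ_one⟩

theorem Num.succ {n : W} (hn : Num n) : Num (n * sing 1) := by
  refine ⟨hn.1.mul (lin_atom (sing_atom 1)), fun a ha => ?_⟩
  rcases occ_mul.1 ha with h | h
  · exact hn.2 a h
  · exact (occ_atom (sing_atom 1)).1 h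

/-- Letters are the atoms whose entry is a number. -/
def Letter (a : W) : Prop := ∃ n, Num n ∧ a = sing n

theorem Letter.atom {a : W} (h : Letter a) : Atom a := by
  obtain ⟨n, -, rfl⟩ := h
  exact sing_atom n

/-- The strict order of letters, induced by that of numbers. -/
def LetterLt (a b : W) : Prop :=
  ∃ n m t, Num n ∧ Num m ∧ a = sing n ∧ b = sing m ∧ t ≠ 1 ∧ m = n * t

/-- The order of letters (reflexive on all elements). -/
def LetterLe (a b : W) : Prop := a = b ∨ LetterLt a b

theorem LetterLt.left {a b : W} (h : LetterLt a b) : Letter a := by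
  obtain ⟨n, m, t, hn, hm, rfl, rfl, ht, e⟩ := h
  exact ⟨n, hn, rfl⟩

theorem LetterLt.right {a b : W} (h : LetterLt a b) : Letter b := by
  obtain ⟨n, m, t, hn, hm, rfl, rfl, ht, e⟩ := h
  exact ⟨m, hm, rfl⟩

theorem LetterLt.trans {a b c : W} (h : LetterLt a b) (h' : LetterLt b c) : LetterLt a c := by
  obtain ⟨n, m, t, hn, hm, rfl, rfl, ht, rfl⟩ := h
  obtain ⟨n', m', t', hn', hm', e, rfl, ht', rfl⟩ := h'
  obtain rfl := sing_inj _ _ e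
  exact ⟨n, _, t * t', hn, hm', rfl, rfl, mul_ne_one_left _ ht, by simp only [mul_assoc]⟩

theorem LetterLt.irrefl {a : W} (h : LetterLt a a) : False := by
  obtain ⟨n, m, t, hn, hm, rfl, e, ht, rfl⟩ := h
  exact ht (mul_right_eq_self (sing_inj _ _ e))

theorem LetterLt.le {a b : W} (h : LetterLt a b) : LetterLe a b := Or.inr h

theorem LetterLe.refl (a : W) : LetterLe a a := Or.inl rfl

theorem LetterLe.trans_lt {a b c : W} (h : LetterLe a b) (h' : LetterLt b c) : LetterLt a c := by
  rcases h with rfl | h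
  · exact h'
  · exact h.trans h'

theorem LetterLt.trans_le {a b c : W} (h : LetterLt a b) (h' : LetterLe b c) : LetterLt a c := by
  rcases h' with rfl | h'
  · exact h
  · exact h.trans h'

theorem LetterLe.trans {a b c : W} (h : LetterLe a b) (h' : LetterLe b c) : LetterLe a c := by
  rcases h with rfl | h
  · exact h'
  · exact (h.trans_le h').le

theorem LetterLt.not_le {a b : W} (h : LetterLt a b) (h' : LetterLe b a) : False :=
  (h.trans_le h').irrefl

theorem Letter.lt_or_le {a b : W} (ha : Letter a) (hb : Letter b) :
    LetterLt a b ∨ LetterLe b a := by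
  obtain ⟨n, hn, rfl⟩ := ha
  obtain ⟨m, hm, rfl⟩ := hb
  rcases hn.1.comparable m with ⟨t, rfl⟩ | ⟨t, rfl⟩ | ⟨p, a, b, s, t, ha, hb, hab, e1, e2⟩
  · by_cases ht : t = 1
    · exact Or.inr (Or.inl (by simp [ht]))
    · exact Or.inl ⟨n, _, t, hn, hm, rfl, rfl, ht, rfl⟩
  · by_cases ht : t = 1
    · exact Or.inr (Or.inl (by simp [ht]))
    · exact Or.inr (Or.inr ⟨m, _, t, hm, hn, rfl, rfl, ht, rfl⟩)
  · exact absurd ((hn.2 a ⟨ha, p, s, e1⟩).trans (hm.2 b ⟨hb, p, t, e2⟩).symm) hab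

theorem Letter.trichotomy {a b : W} (ha : Letter a) (hb : Letter b) :
    LetterLt a b ∨ a = b ∨ LetterLt b a := by
  rcases ha.lt_or_le hb with h | h | h
  · exact Or.inl h
  · exact Or.inr (Or.inl h.symm)
  · exact Or.inr (Or.inr h)

theorem LetterLt.ne {a b : W} (h : LetterLt a b) : a ≠ b := by
  rintro rfl
  exact h.irrefl

theorem not_letterLt_zero {a : W} : ¬ LetterLt a (sing (1 : W)) := by
  rintro ⟨n, m, t, hn, hm, rfl, e, ht, rfl⟩
  exact ht (eq_one_right (sing_inj _ _ e).symm)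

theorem Num.lt_succ {n : W} (hn : Num n) : LetterLt (sing n) (sing (n * sing 1)) :=
  ⟨n, _, sing 1, hn, hn.succ, rfl, rfl, (sing_atom 1).1, rfl⟩

theorem LetterLt.exists_of_succ {n m : W} (h : LetterLt (sing n) (sing (m * sing 1))) :
    ∃ t, m = n * t := by
  obtain ⟨n', m', t, hn, hm, e1, e2, ht, rfl⟩ := h
  obtain rfl := sing_inj _ _ e1
  obtain ⟨u, ⟨h1, h2⟩ | ⟨h1, -⟩⟩ := SeqMonoid.refinement _ _ _ _ (sing_inj _ _ e2)
  · rcases (sing_atom (1 : W)).2 _ _ h2.symm with rfl | h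
    · exact ⟨1, by rw [h1, mul_one, mul_one]⟩
    · exact absurd h ht
  · exact ⟨u, h1⟩

/-! ### Blocks -/

theorem left_factor_atom_mul {a z t s : W} (ha : Atom a) (h : z * t = a * s) :
    z = 1 ∨ ∃ z', z = a * z' ∧ s = z' * t := by
  rcases first z with rfl | ⟨b, z', hb, rfl⟩
  · exact Or.inl rfl
  · rw [mul_assoc] at h
    obtain ⟨rfl, h1⟩ := atom_mul_inj hb ha h
    exact Or.inr ⟨z', rfl, h1.symm⟩

theorem occ_head {a t : W} (ha : Atom a) : Occ a (a * t) := ⟨ha, 1, t, by simp⟩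

/-- All entries of `w` are letters below `k`. -/
def AllLt (w k : W) : Prop := ∀ a, Occ a w → LetterLt a k

/-- All entries of `p` are at most `k`. -/
def AllLe (p k : W) : Prop := ∀ a, Occ a p → LetterLe a k

/-- `q` is empty or its first entry is at least `k`. -/
def HeadGe (q k : W) : Prop := ∀ a t, Atom a → q = a * t → LetterLe k a

/-- The pair `(k, w)` stands for the block `k * w`: a letter followed by strictly smaller ones. -/
def IsBlock (k w : W) : Prop := Letter k ∧ AllLt w k

/-- In `p * s`, the second factor is empty or starts with a weak record, i.e. with an entry that
no earlier entry exceeds. -/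
def Boundary (p s : W) : Prop := ∀ a t, Atom a → s = a * t → AllLe p a

/-- `y` is one of the blocks into which `u` is cut at its weak records. -/
def BlockOf (y u : W) : Prop :=
  ∃ p k w q, y = k * w ∧ u = p * (k * w) * q ∧ IsBlock k w ∧ AllLe p k ∧ HeadGe q k

theorem allLt_one (k : W) : AllLt (1 : W) k := fun _ h => absurd h occ_one

theorem allLe_one (k : W) : AllLe (1 : W) k := fun _ h => absurd h occ_one

theorem allLt_mul {x y k : W} : AllLt (x * y) k ↔ AllLt x k ∧ AllLt y k := by
  simp only [AllLt, occ_mul, or_imp, forall_and]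

theorem allLe_mul {x y k : W} : AllLe (x * y) k ↔ AllLe x k ∧ AllLe y k := by
  simp only [AllLe, occ_mul, or_imp, forall_and]

theorem allLt_atom {a k : W} (ha : Atom a) : AllLt a k ↔ LetterLt a k := by
  simp [AllLt, occ_atom ha]

theorem allLe_atom {a k : W} (ha : Atom a) : AllLe a k ↔ LetterLe a k := by
  simp [AllLe, occ_atom ha]

theorem AllLt.allLe {w k : W} (h : AllLt w k) : AllLe w k := fun a ha => (h a ha).le

theorem AllLe.mono {p k l : W} (h : AllLe p k) (h' : LetterLe k l) : AllLe p l :=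
  fun a ha => (h a ha).trans h'

theorem AllLe.trans_lt {p k l : W} (h : AllLe p k) (h' : LetterLt k l) : AllLt p l :=
  fun a ha => (h a ha).trans_lt h'

theorem IsBlock.allLe {k w : W} (h : IsBlock k w) : AllLe (k * w) k :=
  allLe_mul.2 ⟨(allLe_atom h.1.atom).2 (LetterLe.refl k), h.2.allLe⟩

theorem IsBlock.ne_one {k w : W} (h : IsBlock k w) : k * w ≠ 1 := mul_ne_one_left w h.1.atom.1

theorem IsBlock.inj {k w k' w' : W} (h : IsBlock k w) (h' : IsBlock k' w')
    (e : k * w = k' * w') : k = k' ∧ w = w' := atom_mul_inj h.1.atom h'.1.atom e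

theorem headGe_one (k : W) : HeadGe (1 : W) k := fun _ _ ha e =>
  absurd (eq_one_left _ _ e.symm) ha.1

theorem headGe_atom_mul {a t k : W} (ha : Atom a) : HeadGe (a * t) k ↔ LetterLe k a := by
  constructor
  · exact fun h => h a t ha rfl
  · intro h b s hb e
    obtain ⟨rfl, -⟩ := atom_mul_inj ha hb e
    exact h

theorem HeadGe.left {x y k : W} (h : HeadGe (x * y) k) : HeadGe x k := by
  rintro a t ha rfl
  exact h a (t * y) ha (by rw [mul_assoc])

theorem HeadGe.mul_of_ne {x k : W} (h : HeadGe x k) (hx : x ≠ 1) (y : W) :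
    HeadGe (x * y) k := by
  rcases first x with rfl | ⟨a, t, ha, rfl⟩
  · exact absurd rfl hx
  · rw [mul_assoc, headGe_atom_mul ha]
    exact (headGe_atom_mul ha).1 h

theorem boundary_one_left (s : W) : Boundary 1 s := fun _ _ _ _ => allLe_one _

theorem boundary_one_right (p : W) : Boundary p 1 := fun _ _ ha e =>
  absurd (eq_one_left _ _ e.symm) ha.1

theorem boundary_atom_mul {p a t : W} (ha : Atom a) : Boundary p (a * t) ↔ AllLe p a := by
  constructor
  · exact fun h => h a t ha rfl
  · intro h b s hb e
    obtain ⟨rfl, -⟩ := atom_mul_inj ha hb e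
    exact h

theorem Boundary.left {p x y : W} (h : Boundary p (x * y)) : Boundary p x := by
  rintro a t ha rfl
  exact h a (t * y) ha (by rw [mul_assoc])

theorem Boundary.mul_of_ne {p x : W} (h : Boundary p x) (hx : x ≠ 1) (y : W) :
    Boundary p (x * y) := by
  rcases first x with rfl | ⟨a, t, ha, rfl⟩
  · exact absurd rfl hx
  · rw [mul_assoc, boundary_atom_mul ha]
    exact (boundary_atom_mul ha).1 h

theorem boundary_mul_left {p x s : W} :
    Boundary (p * x) s ↔ Boundary p s ∧ Boundary x s := by
  simp only [Boundary, allLe_mul]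
  grind

theorem IsBlock.boundary {k w q : W} (h : IsBlock k w) : Boundary (k * w) q ↔ HeadGe q k := by
  constructor
  · exact fun hb a t ha e => hb a t ha e k (occ_head h.1.atom)
  · exact fun hg a t ha e => h.allLe.mono (hg a t ha e)

/-- A boundary is transitive across a nonempty factor. -/
theorem Boundary.trans {p y q : W} (h : Boundary p y) (hy : y ≠ 1) (h' : Boundary y q) :
    Boundary p q := by
  rcases first y with rfl | ⟨a, t, ha, rfl⟩
  · exact absurd rfl hy
  · exact fun b s hb e =>
      ((boundary_atom_mul ha).1 h).mono (h' b s hb e a (occ_head ha))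

/-- A block occurring in `p * s` does not cross a boundary. -/
theorem Boundary.block_side {p s p' k w q : W} (hB : Boundary p s)
    (e : p * s = p' * (k * w) * q) (hk : IsBlock k w) :
    (∃ r, q = r * s ∧ p = p' * (k * w) * r) ∨ ∃ r, p' = p * r ∧ s = r * (k * w) * q := by
  rw [mul_assoc] at e
  obtain ⟨z, ⟨rfl, h2⟩ | ⟨rfl, h2⟩⟩ := SeqMonoid.refinement _ _ _ _ e
  · exact Or.inr ⟨z, rfl, by rw [← h2]; simp only [mul_assoc]⟩
  rw [mul_assoc] at h2
  rcases left_factor_atom_mul hk.1.atom h2 with rfl | ⟨z', rfl, h3⟩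
  · exact Or.inr ⟨1, by simp, by simpa [mul_assoc] using h2⟩
  obtain ⟨x, ⟨rfl, h4⟩ | ⟨rfl, h4⟩⟩ := SeqMonoid.refinement _ _ _ _ h3
  · exact Or.inl ⟨x, h4.symm, by simp only [mul_assoc]⟩
  rcases first x with rfl | ⟨a, t, ha, rfl⟩
  · exact Or.inl ⟨1, by simpa using h4, by simp⟩
  -- Here the first entry `a` of `s` lies in the block, so it is smaller than `k`.
  have h5 : LetterLt a k := hk.2 a (occ_mul.2 (Or.inr (occ_head ha)))
  rw [← h4, mul_assoc, boundary_atom_mul ha] at hB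
  exact (h5.not_le (hB k (occ_mul.2 (Or.inr (occ_head hk.1.atom))))).elim

theorem not_blockOf_one {y : W} : ¬ BlockOf y 1 := by
  rintro ⟨p, k, w, q, rfl, e, hk, -⟩
  exact hk.ne_one (eq_one_right (eq_one_left _ _ e.symm))

/-- The blocks of a product with a boundary are those of the factors. -/
theorem Boundary.blockOf_mul {p s y : W} (hB : Boundary p s) :
    BlockOf y (p * s) ↔ BlockOf y p ∨ BlockOf y s := by
  constructor
  · rintro ⟨p', k, w, q, rfl, e, hk, hp, hq⟩
    rcases hB.block_side e hk with ⟨r, rfl, rfl⟩ | ⟨r, rfl, rfl⟩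
    · exact Or.inl ⟨p', k, w, r, rfl, rfl, hk, hp, hq.left⟩
    · exact Or.inr ⟨r, k, w, q, rfl, rfl, hk, (allLe_mul.1 hp).2, hq⟩
  · rintro (⟨p', k, w, q, rfl, rfl, hk, hp, hq⟩ | ⟨p', k, w, q, rfl, rfl, hk, hp, hq⟩)
    · refine ⟨p', k, w, q * s, rfl, by simp only [mul_assoc], hk, hp, ?_⟩
      by_cases h1 : q = 1
      · rw [h1, one_mul]
        exact fun a t ha e => hB a t ha e k
          (occ_mul.2 (Or.inl (occ_mul.2 (Or.inr (occ_head hk.1.atom)))))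
      · exact hq.mul_of_ne h1 s
    · refine ⟨p * p', k, w, q, rfl, by simp only [mul_assoc], hk, allLe_mul.2 ⟨?_, hp⟩, hq⟩
      rcases first p' with rfl | ⟨a, t, ha, rfl⟩
      · rw [one_mul, mul_assoc, boundary_atom_mul hk.1.atom] at hB
        exact hB
      · rw [mul_assoc, mul_assoc, boundary_atom_mul ha] at hB
        exact hB.mono (hp a (occ_head ha))

theorem IsBlock.blockOf {k w y : W} (h : IsBlock k w) : BlockOf y (k * w) ↔ y = k * w := by
  constructor
  · rintro ⟨p', k', w', q', rfl, e, hk, hp, hq⟩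
    rw [mul_assoc] at e
    rcases left_factor_atom_mul h.1.atom e.symm with rfl | ⟨p'', rfl, rfl⟩
    · rw [one_mul, mul_assoc] at e
      obtain ⟨rfl, rfl⟩ := atom_mul_inj h.1.atom hk.1.atom e
      rcases first q' with rfl | ⟨a, t, ha, rfl⟩
      · rw [mul_one]
      · have h1 := h.2 a (occ_mul.2 (Or.inr (occ_head ha)))
        exact (h1.not_le ((headGe_atom_mul ha).1 hq)).elim
    · have h1 : LetterLt k' k := h.2 k' (by
        rw [mul_assoc]
        exact occ_mul.2 (Or.inr (occ_head hk.1.atom)))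
      exact (h1.not_le (hp k (occ_head h.1.atom))).elim
  · rintro rfl
    exact ⟨1, k, w, 1, rfl, by simp, h, allLe_one _, headGe_one _⟩

/-! ### The lexicographic order -/

/-- The lexicographic order of words, a proper prefix coming first. -/
def Lex (u v : W) : Prop :=
  (∃ t, t ≠ 1 ∧ v = u * t) ∨ ∃ p a b s t, LetterLt a b ∧ u = p * a * s ∧ v = p * b * t

theorem Lex.irrefl {u : W} (h : Lex u u) : False := by
  rcases h with ⟨t, ht, e⟩ | ⟨p, a, b, s, t, hab, e, e'⟩
  · exact ht (mul_right_eq_self e)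
  · rw [e, mul_assoc, mul_assoc] at e'
    exact hab.ne (atom_mul_inj hab.left.atom hab.right.atom (left_cancel _ _ _ e')).1

theorem Lex.trans {u v w : W} (h : Lex u v) (h' : Lex v w) : Lex u w := by
  rcases h with ⟨t, ht, rfl⟩ | ⟨p, a, b, s, t, hab, rfl, rfl⟩ <;>
    rcases h' with ⟨t', ht', rfl⟩ | ⟨p', a', b', s', t', hab', e, rfl⟩
  · exact Or.inl ⟨t * t', mul_ne_one_left _ ht, by simp only [mul_assoc]⟩
  · rw [mul_assoc] at e
    obtain ⟨z, ⟨rfl, -⟩ | ⟨rfl, h1⟩⟩ := SeqMonoid.refinement _ _ _ _ e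
    · refine Or.inl ⟨z * b' * t', ?_, by simp only [mul_assoc]⟩
      exact mul_ne_one_left _ fun h => hab'.right.atom.1 (eq_one_right h)
    · rcases left_factor_atom_mul hab'.left.atom h1 with rfl | ⟨z', rfl, -⟩
      · exact Or.inl ⟨b' * t', mul_ne_one_left _ hab'.right.atom.1,
          by simp only [mul_assoc, one_mul]⟩
      · exact Or.inr ⟨p', a', b', z', t', hab', by simp only [mul_assoc], rfl⟩
  · exact Or.inr ⟨p, a, b, s, t * t', hab, rfl, by simp only [mul_assoc]⟩
  · rw [mul_assoc, mul_assoc] at e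
    obtain ⟨z, ⟨rfl, h1⟩ | ⟨rfl, h1⟩⟩ := SeqMonoid.refinement _ _ _ _ e
    · rcases left_factor_atom_mul hab.right.atom h1 with rfl | ⟨z', rfl, -⟩
      · rw [one_mul] at h1
        obtain ⟨rfl, -⟩ := atom_mul_inj hab'.left.atom hab.right.atom h1
        exact Or.inr ⟨p, a, b', s, t', hab.trans hab', rfl, by simp⟩
      · exact Or.inr ⟨p, a, b, s, z' * b' * t', hab, rfl, by simp only [mul_assoc]⟩
    · rcases left_factor_atom_mul hab'.left.atom h1 with rfl | ⟨z', rfl, -⟩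
      · rw [one_mul] at h1
        obtain ⟨rfl, -⟩ := atom_mul_inj hab.right.atom hab'.left.atom h1
        exact Or.inr ⟨p', a, b', s, t', hab.trans hab', by simp, rfl⟩
      · exact Or.inr ⟨p', a', b', z' * a * s, t', hab', by simp only [mul_assoc], rfl⟩

theorem Lex.letterLe {k w k' w' : W} (hk : Letter k) (hk' : Letter k')
    (h : Lex (k * w) (k' * w')) : LetterLe k k' := by
  rcases h with ⟨t, -, e⟩ | ⟨p, a, b, s, t, hab, e, e'⟩
  · rw [mul_assoc] at e
    exact Or.inl (atom_mul_inj hk'.atom hk.atom e).1.symm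
  · rw [mul_assoc] at e e'
    rcases left_factor_atom_mul hk.atom e.symm with rfl | ⟨z, rfl, -⟩
    · rw [one_mul] at e e'
      obtain ⟨rfl, -⟩ := atom_mul_inj hk.atom hab.left.atom e
      obtain ⟨rfl, -⟩ := atom_mul_inj hk'.atom hab.right.atom e'
      exact hab.le
    · rw [mul_assoc] at e'
      exact Or.inl (atom_mul_inj hk'.atom hk.atom e').1.symm

/-! ### Words -/

/-- `v` can be cut before its first entry that is at least a given letter. -/
def Splits (v : W) : Prop :=
  ∀ d, Letter d → ∃ b q, v = b * q ∧ AllLt b d ∧ HeadGe q d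

theorem Splits.mul_letter {v c : W} (hv : Splits v) (hc : Letter c) : Splits (v * c) := by
  intro d hd
  obtain ⟨b, q, rfl, hb, hq⟩ := hv d hd
  by_cases h1 : q = 1
  · subst h1
    rcases hc.lt_or_le hd with h | h
    · exact ⟨b * c, 1, by simp, allLt_mul.2 ⟨hb, (allLt_atom hc.atom).2 h⟩, headGe_one _⟩
    · refine ⟨b, c, by simp, hb, ?_⟩
      rw [← mul_one c, headGe_atom_mul hc.atom]
      exact h
  · exact ⟨b, q * c, by simp only [mul_assoc], hb, hq.mul_of_ne h1 c⟩

/-- `v` is empty or has a last block. -/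
def HasLastBlock (v : W) : Prop :=
  v = 1 ∨ ∃ a k b, v = a * (k * b) ∧ IsBlock k b ∧ AllLe a k

theorem HasLastBlock.mul_letter {v c : W} (hv : HasLastBlock v) (hc : Letter c) :
    HasLastBlock (v * c) := by
  rcases hv with rfl | ⟨a, k, b, rfl, hk, ha⟩
  · exact Or.inr ⟨1, c, 1, by simp, ⟨hc, allLt_one _⟩, allLe_one _⟩
  · rcases hc.lt_or_le hk.1 with h | h
    · exact Or.inr ⟨a, k, b * c, by simp only [mul_assoc],
        ⟨hk.1, allLt_mul.2 ⟨hk.2, (allLt_atom hc.atom).2 h⟩⟩, ha⟩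
    · exact Or.inr ⟨a * (k * b), c, 1, by simp, ⟨hc, allLt_one _⟩,
        (allLe_mul.2 ⟨ha, hk.allLe⟩).mono h⟩

/-- There is a place for `y` in `v`: all blocks before it are smaller than `y` and the next block,
if there is one, is not. -/
def HasPlace (v y : W) : Prop :=
  ∃ p s, v = p * s ∧ Boundary p s ∧ (∀ z, BlockOf z p → Lex z y) ∧
    (s = 1 ∨ ∃ k w q, s = k * w * q ∧ IsBlock k w ∧ HeadGe q k ∧ ¬ Lex (k * w) y)

/-- If all blocks of `p` are smaller than `y`, then there is a place for `y` in the product of `p`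
with a further block. -/
theorem hasPlace_mul_block {p k w y : W} (hk : IsBlock k w) (hp : AllLe p k)
    (h : ∀ z, BlockOf z p → Lex z y) : HasPlace (p * (k * w)) y := by
  have hB : Boundary p (k * w) := (boundary_atom_mul hk.1.atom).2 hp
  by_cases hy : Lex (k * w) y
  · refine ⟨p * (k * w), 1, by simp, boundary_one_right _, fun z hz => ?_, Or.inl rfl⟩
    rcases hB.blockOf_mul.1 hz with hz | hz
    · exact h z hz
    · rwa [hk.blockOf.1 hz]
  · exact ⟨p, k * w, rfl, hB, h, Or.inr ⟨k, w, 1, by simp, hk, headGe_one _, hy⟩⟩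

theorem HasPlace.mul_letter {v c y : W} (hl : HasLastBlock v) (hv : HasPlace v y)
    (hc : Letter c) : HasPlace (v * c) y := by
  obtain ⟨p, s, rfl, hB, hp, rfl | ⟨k, w, q, rfl, hk, hq, hn⟩⟩ := hv
  · simp only [mul_one] at hl ⊢
    rcases hl with rfl | ⟨a, k, b, rfl, hk, ha⟩
    · simpa using hasPlace_mul_block (w := 1) ⟨hc, allLt_one _⟩ (allLe_one _) hp
    have hB : Boundary a (k * b) := (boundary_atom_mul hk.1.atom).2 ha
    rcases hc.lt_or_le hk.1 with h | h
    · have := hasPlace_mul_block (w := b * c) (y := y)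
        ⟨hk.1, allLt_mul.2 ⟨hk.2, (allLt_atom hc.atom).2 h⟩⟩ ha
        fun z hz => hp z (hB.blockOf_mul.2 (Or.inl hz))
      simpa only [mul_assoc] using this
    · simpa using hasPlace_mul_block (w := 1) ⟨hc, allLt_one _⟩
        ((allLe_mul.2 ⟨ha, hk.allLe⟩).mono h) hp
  · refine ⟨p, k * w * q * c, by simp only [mul_assoc],
      hB.mul_of_ne (mul_ne_one_left _ hk.ne_one) c, hp, Or.inr ?_⟩
    by_cases h1 : q = 1
    · subst h1
      rcases hc.lt_or_le hk.1 with h | h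
      · -- The block grows by the entry `c`, which makes it larger in the lexicographic order.
        refine ⟨k, w * c, 1, by simp only [mul_assoc, mul_one],
          ⟨hk.1, allLt_mul.2 ⟨hk.2, (allLt_atom hc.atom).2 h⟩⟩, headGe_one _, fun h' => hn ?_⟩
        exact Lex.trans (Or.inl ⟨c, hc.atom.1, by simp only [mul_assoc]⟩) h'
      · refine ⟨k, w, c, by simp, hk, ?_, hn⟩
        rw [← mul_one c, headGe_atom_mul hc.atom]
        exact h
    · exact ⟨k, w, q * c, by simp only [mul_assoc], hk, hq.mul_of_ne h1 c, hn⟩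

/-- The conjunction of the properties, preserved by appending letters, from which the class of words
is built. -/
def WordLike (v : W) : Prop :=
  Lin v ∧ (∀ a, Occ a v → Letter a) ∧ Splits v ∧ HasLastBlock v ∧ ∀ y, HasPlace v y

theorem wordLike_one : WordLike (1 : W) :=
  ⟨core_one, fun _ h => absurd h occ_one,
    fun _ _ => ⟨1, 1, by simp, allLt_one _, headGe_one _⟩, Or.inl rfl,
    fun _ => ⟨1, 1, by simp, boundary_one_left _, fun _ h => absurd h not_blockOf_one, Or.inl rfl⟩⟩

theorem WordLike.mul_letter {v c : W} (hv : WordLike v) (hc : Letter c) : WordLike (v * c) := by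
  obtain ⟨h1, h2, h3, h4, h5⟩ := hv
  refine ⟨h1.mul (lin_atom hc.atom), fun a ha => ?_, h3.mul_letter hc, h4.mul_letter hc,
    fun y => (h5 y).mul_letter h4 hc⟩
  rcases occ_mul.1 ha with h | h
  · exact h2 a h
  · rwa [(occ_atom hc.atom).1 h]

/-- Words: the elements of the cut given by the properties above. -/
def Word (v : W) : Prop := Core WordLike v

theorem Word.wordLike {v : W} (h : Word v) : WordLike v := Core.spec h wordLike_one

theorem Word.left {x y : W} (h : Word (x * y)) : Word x := Core.left h

theorem Word.right {x y : W} (h : Word (x * y)) : Word y := Core.right h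

theorem Word.mul {x y : W} (hx : Word x) (hy : Word y) : Word (x * y) := Core.mul hx hy

theorem word_letter {c : W} (hc : Letter c) : Word c :=
  core_atom hc.atom fun _ hv => hv.mul_letter hc

theorem Word.letter {v a : W} (h : Word v) (ha : Occ a v) : Letter a := h.wordLike.2.1 a ha

theorem Word.lex_total {u v : W} (hu : Word u) (hv : Word v) : Lex u v ∨ u = v ∨ Lex v u := by
  rcases hu.wordLike.1.comparable v with
    ⟨t, rfl⟩ | ⟨t, rfl⟩ | ⟨p, a, b, s, t, ha, hb, hab, rfl, rfl⟩
  · by_cases ht : t = 1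
    · simp [ht]
    · exact Or.inl (Or.inl ⟨t, ht, rfl⟩)
  · by_cases ht : t = 1
    · simp [ht]
    · exact Or.inr (Or.inr (Or.inl ⟨t, ht, rfl⟩))
  · have la : Letter a := hu.letter ⟨ha, p, s, rfl⟩
    have lb : Letter b := hv.letter ⟨hb, p, t, rfl⟩
    rcases la.trichotomy lb with h | h | h
    · exact Or.inl (Or.inr ⟨p, a, b, s, t, h, rfl, rfl⟩)
    · exact absurd h hab
    · exact Or.inr (Or.inr (Or.inr ⟨p, b, a, t, s, h, rfl, rfl⟩))

/-! ### Sorted words -/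

/-- The blocks of `u` are strictly increasing in the lexicographic order. -/
def Sorted (u : W) : Prop :=
  ∀ p s, u = p * s → Boundary p s → ∀ y z, BlockOf y p → BlockOf z s → Lex y z

theorem sorted_one : Sorted (1 : W) := by
  intro p s e _ y z hy
  rw [eq_one_left _ _ e.symm] at hy
  exact absurd hy not_blockOf_one

/-- A word that continues the smaller letters `c` after `k` with a letter `b` below `k`, and a word
that continues them otherwise, have different blocks at `k`. -/
theorem block_ne {c k b t s b₁ b₂ q₁ q₂ : W} (hc : AllLt c k) (hb : LetterLt b k)
    (hs : ∀ t', s ≠ b * t') (e₁ : c * s = b₁ * q₁) (e₂ : c * (b * t) = b₂ * q₂)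
    (hq : HeadGe q₂ k) : b₁ ≠ b₂ := by
  rintro rfl
  obtain ⟨z, ⟨rfl, h2⟩ | ⟨rfl, h2⟩⟩ := SeqMonoid.refinement _ _ _ _ e₂
  · rcases left_factor_atom_mul hb.left.atom h2 with rfl | ⟨z', rfl, -⟩
    · rw [one_mul] at h2
      rw [h2, headGe_atom_mul hb.left.atom] at hq
      exact hb.not_le hq
    · rw [mul_assoc] at e₁
      exact hs (z' * q₁) (by rw [left_cancel _ _ _ e₁, mul_assoc])
  · rcases first z with rfl | ⟨d, z', hd, rfl⟩
    · simp only [mul_one, one_mul] at *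
      rw [← h2, headGe_atom_mul hb.left.atom] at hq
      exact hb.not_le hq
    · rw [← h2, mul_assoc, headGe_atom_mul hd] at hq
      exact (hc d (occ_mul.2 (Or.inr (occ_head hd)))).not_le hq

/-- `s` is a nonempty word and `y` is its first block. -/
def FirstBlock (y s : W) : Prop := ∃ k w q, y = k * w ∧ s = k * w * q ∧ IsBlock k w ∧ HeadGe q k

theorem FirstBlock.boundary_blockOf {y s : W} (h : FirstBlock y s) :
    ∃ q, s = y * q ∧ Boundary y q ∧ (∀ z, BlockOf z y ↔ z = y) := by
  obtain ⟨k, w, q, rfl, rfl, hk, hq⟩ := h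
  exact ⟨q, rfl, hk.boundary.2 hq, fun z => hk.blockOf⟩

theorem FirstBlock.blockOf {y s : W} (h : FirstBlock y s) : BlockOf y s := by
  obtain ⟨q, rfl, hB, hy⟩ := h.boundary_blockOf
  exact hB.blockOf_mul.2 (Or.inl ((hy y).2 rfl))

theorem Word.firstBlock {k v : W} (hk : Letter k) (hv : Word v) :
    ∃ b q, v = b * q ∧ HeadGe q k ∧ FirstBlock (k * b) (k * v) := by
  obtain ⟨b, q, rfl, hb, hq⟩ := hv.wordLike.2.2.1 k hk
  exact ⟨b, q, rfl, hq, k, b, q, rfl, by simp only [mul_assoc], ⟨hk, hb⟩, hq⟩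

/-- `u` and `v` agree up to a boundary of both, after which `v` continues with a block and `u`
stops or continues with a different block. -/
def DifferAtBlock (u v : W) : Prop :=
  ∃ p s t z, u = p * s ∧ v = p * t ∧ Boundary p s ∧ Boundary p t ∧ FirstBlock z t ∧
    (s = 1 ∨ ∃ y, FirstBlock y s ∧ y ≠ z)

/-- Two words that agree on `p`, after which only the second one continues with the letter `b`,
differ at a block: at the block that starts after `p` if both continuations are records, and at the
last block of `p`, prolonged by what follows, otherwise. -/
theorem differAtBlock_of_ne {p s b t : W} (hu : Word (p * s)) (hv : Word (p * (b * t)))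
    (hb : Letter b) (hs : ∀ t', s ≠ b * t') :
    DifferAtBlock (p * s) (p * (b * t)) ∨ DifferAtBlock (p * (b * t)) (p * s) := by
  by_cases hpb : AllLe p b
  · by_cases hB : Boundary p s
    · obtain ⟨b₂, q₂, rfl, -, hf⟩ := Word.firstBlock hb hv.right.right
      refine Or.inl ⟨p, s, _, _, rfl, rfl, hB, (boundary_atom_mul hb.atom).2 hpb, hf, ?_⟩
      rcases first s with rfl | ⟨a, s, ha, rfl⟩
      · exact Or.inl rfl
      · have la : Letter a := hu.letter (occ_mul.2 (Or.inr (occ_head ha)))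
        obtain ⟨b₁, q₁, rfl, -, hf'⟩ := Word.firstBlock la hu.right.right
        refine Or.inr ⟨_, hf', fun e => ?_⟩
        obtain ⟨rfl, -⟩ := atom_mul_inj ha hb.atom e
        exact hs _ rfl
    · -- `s` starts with a letter `a` that is not a record, so `a` prolongs the last block of `p`.
      rcases first s with rfl | ⟨a, s, ha, rfl⟩
      · exact absurd (boundary_one_right p) hB
      rw [boundary_atom_mul ha] at hB
      have la : Letter a := hu.letter (occ_mul.2 (Or.inr (occ_head ha)))
      rcases hu.left.wordLike.2.2.2.1 with rfl | ⟨p, k, c, rfl, hk, hp⟩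
      · exact absurd (allLe_one a) hB
      have hak : LetterLt a k := (la.lt_or_le hk.1).resolve_right fun h =>
        hB ((allLe_mul.2 ⟨hp, hk.allLe⟩).mono h)
      have hu' : Word (c * (a * s)) := by
        rw [mul_assoc, mul_assoc] at hu
        exact hu.right.right
      have hv' : Word (c * (b * t)) := by
        rw [mul_assoc, mul_assoc] at hv
        exact hv.right.right
      obtain ⟨b₁, q₁, e₁, hq₁, hf₁⟩ := Word.firstBlock hk.1 hu'
      obtain ⟨b₂, q₂, e₂, hq₂, hf₂⟩ := Word.firstBlock hk.1 hv'
      refine Or.inr ⟨p, k * (c * (b * t)), k * (c * (a * s)), _, by simp only [mul_assoc],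
        by simp only [mul_assoc], (boundary_atom_mul hk.1.atom).2 hp,
        (boundary_atom_mul hk.1.atom).2 hp, hf₁, Or.inr ⟨_, hf₂, fun e => ?_⟩⟩
      refine block_ne hk.2 hak (fun t' e' => ?_) e₂ e₁ hq₁ (left_cancel _ _ _ e)
      obtain ⟨rfl, -⟩ := atom_mul_inj hb.atom ha e'
      exact hs _ rfl
  · rcases hu.left.wordLike.2.2.2.1 with rfl | ⟨p, k, c, rfl, hk, hp⟩
    · exact absurd (allLe_one b) hpb
    have hbk : LetterLt b k := (hb.lt_or_le hk.1).resolve_right fun h =>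
      hpb ((allLe_mul.2 ⟨hp, hk.allLe⟩).mono h)
    have hu' : Word (c * s) := by
      rw [mul_assoc, mul_assoc] at hu
      exact hu.right.right
    have hv' : Word (c * (b * t)) := by
      rw [mul_assoc, mul_assoc] at hv
      exact hv.right.right
    obtain ⟨b₁, q₁, e₁, hq₁, hf₁⟩ := Word.firstBlock hk.1 hu'
    obtain ⟨b₂, q₂, e₂, hq₂, hf₂⟩ := Word.firstBlock hk.1 hv'
    exact Or.inl ⟨p, k * (c * s), k * (c * (b * t)), _, by simp only [mul_assoc],
      by simp only [mul_assoc], (boundary_atom_mul hk.1.atom).2 hp,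
      (boundary_atom_mul hk.1.atom).2 hp, hf₂, Or.inr ⟨_, hf₁, fun e =>
        block_ne hk.2 hbk hs e₁ e₂ hq₂ (left_cancel _ _ _ e)⟩⟩

theorem Word.eq_or_differAtBlock {u v : W} (hu : Word u) (hv : Word v) :
    u = v ∨ DifferAtBlock u v ∨ DifferAtBlock v u := by
  rcases hu.wordLike.1.comparable v with
    ⟨t, rfl⟩ | ⟨t, rfl⟩ | ⟨p, a, b, s, t, ha, hb, hab, rfl, rfl⟩
  · rcases first t with rfl | ⟨b, t, hb, rfl⟩
    · simp
    · have lb : Letter b := hv.letter (occ_mul.2 (Or.inr (occ_head hb)))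
      have := differAtBlock_of_ne (s := 1) (by simpa using hu) hv lb
        fun t' e => hb.1 (eq_one_left _ _ e.symm)
      rw [mul_one] at this
      exact Or.inr this
  · rcases first t with rfl | ⟨b, t, hb, rfl⟩
    · simp
    · have lb : Letter b := hu.letter (occ_mul.2 (Or.inr (occ_head hb)))
      have := differAtBlock_of_ne (s := 1) (by simpa using hv) hu lb
        fun t' e => hb.1 (eq_one_left _ _ e.symm)
      rw [mul_one] at this
      exact Or.inr this.symm
  · have lb : Letter b := hv.letter ⟨hb, p, t, rfl⟩
    rw [mul_assoc] at hu hv ⊢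
    rw [mul_assoc]
    refine Or.inr (differAtBlock_of_ne hu hv lb fun t' e => hab ?_)
    exact (atom_mul_inj ha hb e).1

/-- If `y` is the first block of `s`, a larger block occurs at the same place of `p * t`, and both
words are sorted, then `y` is not a block of `p * t`. -/
theorem not_blockOf_of_lt {p s t y z : W} (hu : Sorted (p * s)) (hv : Sorted (p * t))
    (hs : Boundary p s) (ht : Boundary p t) (hy : FirstBlock y s) (hz : FirstBlock z t)
    (hyz : Lex y z) : ¬ BlockOf y (p * t) := by
  intro h
  rcases ht.blockOf_mul.1 h with h | h
  · exact (hu p s rfl hs y y h hy.blockOf).irrefl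
  obtain ⟨q, rfl, hB, hzz⟩ := hz.boundary_blockOf
  rcases hB.blockOf_mul.1 h with h | h
  · rw [(hzz y).1 h] at hyz
    exact hyz.irrefl
  · have hzne : z ≠ 1 := by
      rintro rfl
      exact not_blockOf_one ((hzz 1).2 rfl)
    have := hv (p * z) q (by rw [mul_assoc])
      (boundary_mul_left.2 ⟨ht.left.trans hzne hB, hB⟩) z y
      (ht.left.blockOf_mul.2 (Or.inr ((hzz z).2 rfl))) h
    exact (this.trans hyz).irrefl

theorem DifferAtBlock.exists_block {u v : W} (wu : Word u) (wv : Word v) (hu : Sorted u)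
    (hv : Sorted v) (h : DifferAtBlock u v) :
    ∃ y, ¬ (BlockOf y u ↔ BlockOf y v) := by
  obtain ⟨p, s, t, z, rfl, rfl, hs, ht, hz, rfl | ⟨y, hy, hyz⟩⟩ := h
  · refine ⟨z, fun h => ?_⟩
    have h1 := h.2 (ht.blockOf_mul.2 (Or.inr hz.blockOf))
    rw [mul_one] at h1
    exact (hv p t rfl ht z z h1 hz.blockOf).irrefl
  · have wy : Word y := by
      obtain ⟨q, rfl, -⟩ := hy.boundary_blockOf
      exact wu.right.left
    have wz : Word z := by
      obtain ⟨q, rfl, -⟩ := hz.boundary_blockOf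
      exact wv.right.left
    rcases wy.lex_total wz with h | h | h
    · exact ⟨y, fun e => not_blockOf_of_lt hu hv hs ht hy hz h
        (e.1 (hs.blockOf_mul.2 (Or.inr hy.blockOf)))⟩
    · exact absurd h hyz
    · exact ⟨z, fun e => not_blockOf_of_lt hv hu ht hs hz hy h
        (e.2 (ht.blockOf_mul.2 (Or.inr hz.blockOf)))⟩

/-- A sorted word is determined by its blocks. -/
theorem Sorted.ext {u v : W} (wu : Word u) (wv : Word v) (hu : Sorted u) (hv : Sorted v)
    (h : ∀ y, BlockOf y u ↔ BlockOf y v) : u = v := by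
  rcases wu.eq_or_differAtBlock wv with e | e | e
  · exact e
  · obtain ⟨y, hy⟩ := e.exists_block wu wv hu hv
    exact absurd (h y) hy
  · obtain ⟨y, hy⟩ := e.exists_block wv wu hv hu
    exact absurd (h y).symm hy

/-- Inserting a block that is larger than all blocks of `p` and smaller than all blocks of `s`. -/
theorem Sorted.insert {p s k w : W} (hk : IsBlock k w) (hu : Sorted (p * s))
    (hps : Boundary p s) (hp : Boundary p (k * w)) (hs : Boundary (k * w) s)
    (hlt : ∀ z, BlockOf z p → Lex z (k * w)) (hgt : ∀ z, BlockOf z s → Lex (k * w) z) :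
    Sorted (p * (k * w * s)) := by
  intro p' s' e hB y z hy hz
  obtain ⟨x, ⟨rfl, h2⟩ | ⟨rfl, h2⟩⟩ := SeqMonoid.refinement _ _ _ _ e
  · -- The cut lies after `p`.
    have key : (x = 1 ∧ k * w * s = s') ∨ ∃ x', x = k * w * x' ∧ s = x' * s' := by
      obtain ⟨x', ⟨h3, h4⟩ | ⟨h3, h4⟩⟩ := SeqMonoid.refinement _ _ _ _ h2
      · rcases first x' with rfl | ⟨a, t, ha, rfl⟩
        · exact Or.inr ⟨1, by rw [h3]; simp, by rw [one_mul, ← h4, one_mul]⟩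
        rcases left_factor_atom_mul hk.1.atom h3.symm with rfl | ⟨x, rfl, rfl⟩
        · exact Or.inl ⟨rfl, by rw [← h2, one_mul]⟩
        -- A boundary cannot lie inside the block.
        rw [← h4, mul_assoc, boundary_atom_mul ha] at hB
        have h5 := hB k (occ_mul.2 (Or.inr (occ_head hk.1.atom)))
        exact ((hk.2 a (occ_mul.2 (Or.inr (occ_head ha)))).not_le h5).elim
      · exact Or.inr ⟨x', h3, h4.symm⟩
    rcases key with ⟨rfl, rfl⟩ | ⟨x', rfl, rfl⟩
    · rw [mul_one] at hy
      rcases hs.blockOf_mul.1 hz with hz | hz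
      · rw [hk.blockOf.1 hz]
        exact hlt y hy
      · exact hu p s rfl hps y z hy hz
    · have hB1 := (boundary_mul_left.1 hB).1
      have hB2 := (boundary_mul_left.1 (boundary_mul_left.1 hB).2).2
      have hz' : BlockOf z (x' * s') := hB2.blockOf_mul.2 (Or.inr hz)
      have hps' : Boundary p x' := hps.left
      rcases (hp.mul_of_ne hk.ne_one x').blockOf_mul.1 hy with hy | hy
      · exact hu (p * x') s' (by rw [mul_assoc]) (boundary_mul_left.2 ⟨hB1, hB2⟩) y z
          (hps'.blockOf_mul.2 (Or.inl hy)) hz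
      rcases hs.left.blockOf_mul.1 hy with hy | hy
      · rw [hk.blockOf.1 hy]
        exact hgt z hz'
      · exact hu (p * x') s' (by rw [mul_assoc]) (boundary_mul_left.2 ⟨hB1, hB2⟩) y z
          (hps'.blockOf_mul.2 (Or.inr hy)) hz
  · -- The cut lies in `p`.
    subst h2
    have hx : Boundary x (k * w * s) := (boundary_mul_left.1 hp).2.mul_of_ne hk.ne_one s
    have hxs : Boundary x s := (boundary_mul_left.1 hps).2
    have hp' : Boundary p' (x * s) := by
      by_cases h1 : x = 1
      · subst h1
        simpa using hps
      · exact hB.left.mul_of_ne h1 s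
    have hy' : BlockOf y (p' * x) := hB.left.blockOf_mul.2 (Or.inl hy)
    have hu' : ∀ z, BlockOf z (x * s) → Lex y z := fun z hz =>
      hu p' (x * s) (by rw [mul_assoc]) hp' y z hy hz
    rcases hx.blockOf_mul.1 hz with hz | hz
    · exact hu' z (hxs.blockOf_mul.2 (Or.inl hz))
    rcases hs.blockOf_mul.1 hz with hz | hz
    · rw [hk.blockOf.1 hz]
      exact hlt y hy'
    · exact hu' z (hxs.blockOf_mul.2 (Or.inr hz))

/-! ### Hereditarily sorted blocks -/

/-- The block `k * w` is a normal form: `w` is sorted and `k` is the least letter above all entries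
of `w`. -/
def Normal (k w : W) : Prop :=
  (k = sing 1 ∨ ∃ n, k = sing (n * sing 1) ∧ Occ (sing n) w) ∧ Sorted w

/-- Every maximal block occurring anywhere in `v` is a normal form. -/
def Hereditary (v : W) : Prop :=
  ∀ p k w q, v = p * (k * w) * q → IsBlock k w → HeadGe q k → Normal k w

theorem hereditary_one : Hereditary (1 : W) := by
  intro p k w q e hk _
  exact absurd (eq_one_right (eq_one_left _ _ e.symm)) hk.ne_one

theorem Hereditary.right {x y : W} (h : Hereditary (x * y)) : Hereditary y := by
  rintro p k w q rfl hk hq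
  exact h (x * p) k w q (by simp only [mul_assoc]) hk hq

theorem Boundary.hereditary_mul {p s : W} (hB : Boundary p s) :
    Hereditary (p * s) ↔ Hereditary p ∧ Hereditary s := by
  constructor
  · refine fun h => ⟨?_, h.right⟩
    rintro p' k w q rfl hk hq
    refine h p' k w (q * s) (by simp only [mul_assoc]) hk ?_
    by_cases h1 : q = 1
    · rw [h1, one_mul]
      exact fun a t ha e => hB a t ha e k
        (occ_mul.2 (Or.inl (occ_mul.2 (Or.inr (occ_head hk.1.atom)))))
    · exact hq.mul_of_ne h1 s
  · rintro ⟨h1, h2⟩ p' k w q e hk hq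
    rcases hB.block_side e hk with ⟨r, rfl, rfl⟩ | ⟨r, rfl, rfl⟩
    · exact h1 p' k w r rfl hk hq.left
    · exact h2 r k w q rfl hk hq

theorem IsBlock.hereditary {k w : W} (h : IsBlock k w) :
    Hereditary (k * w) ↔ Normal k w ∧ Hereditary w := by
  constructor
  · exact fun hh => ⟨hh 1 k w 1 (by simp) h (headGe_one k), hh.right⟩
  · rintro ⟨h1, h2⟩ p k' w' q e hk hq
    rw [mul_assoc] at e
    rcases left_factor_atom_mul h.1.atom e.symm with rfl | ⟨p, rfl, rfl⟩
    · rw [one_mul, mul_assoc] at e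
      obtain ⟨rfl, rfl⟩ := atom_mul_inj h.1.atom hk.1.atom e
      rcases first q with rfl | ⟨a, t, ha, rfl⟩
      · rwa [mul_one] at h1
      · have h3 := h.2 a (occ_mul.2 (Or.inr (occ_head ha)))
        exact (h3.not_le ((headGe_atom_mul ha).1 hq)).elim
    · exact h2 p k' w' q (by simp only [mul_assoc]) hk hq

theorem BlockOf.hereditary {y u : W} (h : BlockOf y u) (hu : Hereditary u) : Hereditary y := by
  obtain ⟨p, k, w, q, rfl, rfl, hk, hp, hq⟩ := h
  rw [mul_assoc] at hu
  exact ((hk.boundary.2 hq).hereditary_mul.1 hu.right).1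

theorem BlockOf.word {y u : W} (h : BlockOf y u) (hu : Word u) : Word y := by
  obtain ⟨p, k, w, q, rfl, rfl, -⟩ := h
  exact hu.left.right

/-- The domain of the interpretation. The block `k * w` stands for the set whose elements are the
blocks of `w`, and `k` is the rank of this set. -/
def IsSet (x : W) : Prop := Word x ∧ Hereditary x ∧ ∃ k w, x = k * w ∧ IsBlock k w

/-- The membership relation of the interpretation. -/
def MemSet (y x : W) : Prop := ∃ k w, x = k * w ∧ IsBlock k w ∧ BlockOf y w

theorem IsBlock.memSet {k w y : W} (h : IsBlock k w) : MemSet y (k * w) ↔ BlockOf y w := by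
  constructor
  · rintro ⟨k', w', e, h', hy⟩
    rwa [(h.inj h' e).2]
  · exact fun hy => ⟨k, w, rfl, h, hy⟩

theorem IsSet.of_mem {y x : W} (hx : IsSet x) (h : MemSet y x) : IsSet y := by
  obtain ⟨k, w, rfl, hk, hy⟩ := h
  refine ⟨hy.word hx.1.right, hy.hereditary hx.2.1.right, ?_⟩
  obtain ⟨p, k, w, q, rfl, -, hk, -⟩ := hy
  exact ⟨k, w, rfl, hk⟩

theorem Normal.letter_unique {k k' w : W} (h : IsBlock k w) (h' : IsBlock k' w)
    (hn : Normal k w) (hn' : Normal k' w) : k = k' := by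
  have zero : ∀ {n : W}, IsBlock (sing 1) w → ¬ Occ (sing n) w := fun h ho =>
    not_letterLt_zero (h.2 _ ho)
  rcases hn.1 with rfl | ⟨n, rfl, ho⟩ <;> rcases hn'.1 with rfl | ⟨m, rfl, ho'⟩
  · rfl
  · exact absurd ho' (zero h)
  · exact absurd ho (zero h')
  · obtain ⟨t, e⟩ := (h.2 _ ho').exists_of_succ
    obtain ⟨t', e'⟩ := (h'.2 _ ho).exists_of_succ
    have h1 : t' * t = 1 := mul_right_eq_self (x := n) (by rw [← mul_assoc, ← e', ← e])
    rw [e', eq_one_left _ _ h1, mul_one]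

theorem IsSet.ext {x y : W} (hx : IsSet x) (hy : IsSet y)
    (h : ∀ z, IsSet z → (MemSet z x ↔ MemSet z y)) : x = y := by
  have h' : ∀ z, MemSet z x ↔ MemSet z y := fun z =>
    ⟨fun hz => (h z (hx.of_mem hz)).1 hz, fun hz => (h z (hy.of_mem hz)).2 hz⟩
  obtain ⟨wx, ix, k, w, rfl, hk⟩ := hx
  obtain ⟨wy, iy, k', w', rfl, hk'⟩ := hy
  simp only [hk.memSet, hk'.memSet] at h'
  have nx := (hk.hereditary.1 ix).1
  have ny := (hk'.hereditary.1 iy).1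
  obtain rfl := Sorted.ext wx.right wy.right nx.2 ny.2 h'
  rw [Normal.letter_unique hk hk' nx ny]

theorem exists_empty_set : ∃ x : W, IsSet x ∧ ∀ y, ¬ MemSet y x := by
  have l : Letter (sing (1 : W)) := ⟨1, num_one, rfl⟩
  have hk : IsBlock (sing (1 : W)) 1 := ⟨l, allLt_one _⟩
  refine ⟨sing 1 * 1,
    ⟨?_, hk.hereditary.2 ⟨⟨Or.inl rfl, sorted_one⟩, hereditary_one⟩, _, _, rfl, hk⟩,
    fun y => by rw [hk.memSet]; exact not_blockOf_one⟩
  rw [mul_one]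
  exact word_letter l

theorem exists_adjoin {x y : W} (hx : IsSet x) (hy : IsSet y) :
    ∃ z, IsSet z ∧ ∀ t, MemSet t z ↔ MemSet t x ∨ t = y := by
  obtain ⟨wx, ix, l, u, rfl, hl⟩ := hx
  obtain ⟨wy, iy, k, w, rfl, hk⟩ := hy
  simp only [hl.memSet]
  by_cases hmem : BlockOf (k * w) u
  · refine ⟨l * u, ⟨wx, ix, l, u, rfl, hl⟩, fun t => ?_⟩
    rw [hl.memSet]
    exact ⟨Or.inl, fun h => h.elim id fun h => h ▸ hmem⟩
  obtain ⟨nx, iu⟩ := hl.hereditary.1 ix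
  obtain ⟨p, s, rfl, hps, hlt, hs⟩ := wx.right.wordLike.2.2.2.2 (k * w)
  have wp : Word p := wx.right.left
  have ws : Word s := wx.right.right
  have hp : Boundary p (k * w) := by
    rw [boundary_atom_mul hk.1.atom]
    rcases wp.wordLike.2.2.2.1 with rfl | ⟨a, j, b, rfl, hj, ha⟩
    · exact allLe_one k
    · refine (allLe_mul.2 ⟨ha, hj.allLe⟩).mono (Lex.letterLe hj.1 hk.1 (hlt (j * b) ?_))
      exact ((boundary_atom_mul hj.1.atom).2 ha).blockOf_mul.2 (Or.inr (hj.blockOf.2 rfl))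
  have hs' : Boundary (k * w) s ∧ ∀ z, BlockOf z s → Lex (k * w) z := by
    rcases hs with rfl | ⟨j, b, q, rfl, hj, hq, hn⟩
    · exact ⟨boundary_one_right _, fun z hz => absurd hz not_blockOf_one⟩
    have hB : Boundary (j * b) q := hj.boundary.2 hq
    have hyz : Lex (k * w) (j * b) := by
      rcases wy.lex_total ws.left with h | h | h
      · exact h
      · refine absurd ?_ hmem
        rw [h]
        exact hps.blockOf_mul.2 (Or.inr (hB.blockOf_mul.2 (Or.inl (hj.blockOf.2 rfl))))
      · exact absurd h hn
    refine ⟨hk.boundary.2 ?_, fun z hz => ?_⟩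
    · rw [mul_assoc, headGe_atom_mul hj.1.atom]
      exact hyz.letterLe hk.1 hj.1
    · rcases hB.blockOf_mul.1 hz with hz | hz
      · rwa [hj.blockOf.1 hz]
      · refine hyz.trans (nx.2 (p * (j * b)) q (by simp only [mul_assoc]) ?_ _ _ ?_ hz)
        · exact boundary_mul_left.2 ⟨hps.left.trans hj.ne_one hB, hB⟩
        · exact hps.left.blockOf_mul.2 (Or.inr (hj.blockOf.2 rfl))
  obtain ⟨hs, hgt⟩ := hs'
  have hp' : Boundary p (k * w * s) := hp.mul_of_ne hk.ne_one s
  have srt : Sorted (p * (k * w * s)) := Sorted.insert hk nx.2 hps hp hs hlt hgt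
  have her : Hereditary (p * (k * w * s)) := by
    obtain ⟨h1, h2⟩ := hps.hereditary_mul.1 iu
    exact hp'.hereditary_mul.2 ⟨h1, hs.hereditary_mul.2 ⟨iy, h2⟩⟩
  have wrd : Word (p * (k * w * s)) := wp.mul (wy.mul ws)
  -- The rank of the new set is the maximum of `l` and the successor of `k`.
  obtain ⟨r, hr, hn⟩ : ∃ r, IsBlock r (p * (k * w * s)) ∧ Normal r (p * (k * w * s)) := by
    have occ : ∀ a, Occ a (p * s) → Occ a (p * (k * w * s)) := fun a h => by
      rcases occ_mul.1 h with h | h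
      · exact occ_mul.2 (Or.inl h)
      · exact occ_mul.2 (Or.inr (occ_mul.2 (Or.inr h)))
    obtain ⟨hlp, hls⟩ := allLt_mul.1 hl.2
    rcases hk.1.lt_or_le hl.1 with h | h
    · refine ⟨l, ⟨hl.1, allLt_mul.2 ⟨hlp, allLt_mul.2 ⟨hk.allLe.trans_lt h, hls⟩⟩⟩, ?_, srt⟩
      exact nx.1.imp id fun ⟨n, e, ho⟩ => ⟨n, e, occ _ ho⟩
    · obtain ⟨n, hn, rfl⟩ := hk.1
      have h1 := hn.lt_succ
      have h2 := h.trans_lt h1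
      refine ⟨sing (n * sing 1), ⟨⟨_, hn.succ, rfl⟩, allLt_mul.2 ⟨hlp.allLe.trans_lt h2,
        allLt_mul.2 ⟨hk.allLe.trans_lt h1, hls.allLe.trans_lt h2⟩⟩⟩, Or.inr ⟨n, rfl, ?_⟩, srt⟩
      exact occ_mul.2 (Or.inr (occ_mul.2 (Or.inl (occ_head hk.1.atom))))
  refine ⟨r * (p * (k * w * s)), ⟨(word_letter hr.1).mul wrd, hr.hereditary.2 ⟨hn, her⟩,
    r, _, rfl, hr⟩, fun t => ?_⟩
  rw [hr.memSet, hp'.blockOf_mul, hs.blockOf_mul, hk.blockOf, hps.blockOf_mul]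
  tauto

end Words

/-! ### Semantics of translations -/

/-- Substituting variables, free or bound, for the free variables of a formula. -/
theorem realize_relabel_formula {L : FirstOrder.Language.{u, v}} {M : Type} [L.Structure M]
    {α β : Type} {n : ℕ} (g : β → α ⊕ Fin n) (φ : L.Formula β) (v : α → M) (xs : Fin n → M) :
    (BoundedFormula.relabel (k := 0) g φ).Realize v xs ↔
      φ.Realize fun b => Sum.elim v xs (g b) := by
  refine BoundedFormula.realize_relabel.trans ?_
  rw [Formula.Realize]
  exact iff_of_eq (congrArg₂ _ rfl (Subsingleton.elim _ _))

namespace Translation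

variable {L : FirstOrder.Language.{u, v}} {L' : FirstOrder.Language.{u', v'}}
  (τ : Translation L L') (M : Type) [L'.Structure M]

/-- The universe of the structure that a translation defines in `M`. -/
def Domain : Type := {x : M // τ.dom.Realize fun _ => x}

instance [L.IsRelational] : L.Structure (τ.Domain M) where
  funMap f _ := isEmptyElim f
  RelMap R xs := (τ.rel R).Realize fun i => (xs i).1

variable {M}

theorem realize_domAt {α : Type} {n : ℕ} (x : α ⊕ Fin n) (v : α → M) (xs : Fin n → M) :
    (τ.domAt x).Realize v xs ↔ τ.dom.Realize fun _ => Sum.elim v xs x :=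
  realize_relabel_formula _ _ _ _

theorem term_realize_eq [L.IsRelational] {γ : Type} {N : Type} [L.Structure N] (t : L.Term γ)
    (v : γ → N) : t.realize v = v (varOf t) := by
  cases t with
  | var x => rfl
  | func f _ => exact isEmptyElim f

/-- The translation of a formula says in `M` what the formula says in the structure defined by
the translation. -/
theorem realize_formula [L.IsRelational] {α : Type} {n : ℕ} (φ : L.BoundedFormula α n)
    (v : α → τ.Domain M) (xs : Fin n → τ.Domain M) :
    (τ.formula φ).Realize (fun a => (v a).1) (fun i => (xs i).1) ↔ φ.Realize v xs := by
  have elim : ∀ {n : ℕ} (xs : Fin n → τ.Domain M) (y : α ⊕ Fin n),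
      Sum.elim (fun a => (v a).1) (fun i => (xs i).1) y = (Sum.elim v xs y).1 := by
    rintro n xs (y | y) <;> rfl
  induction φ with
  | falsum => rfl
  | equal t₁ t₂ =>
    simp only [formula, BoundedFormula.Realize, Term.realize_var, term_realize_eq, elim]
    exact Subtype.ext_iff.symm
  | rel R ts =>
    simp only [formula, BoundedFormula.Realize, term_realize_eq]
    rw [realize_relabel_formula]
    simp only [elim]
    rfl
  | imp φ ψ ih₁ ih₂ => simp only [formula, BoundedFormula.Realize, ih₁, ih₂]
  | all φ ih =>
    simp only [formula, BoundedFormula.Realize, realize_domAt, Sum.elim_inr, Fin.snoc_last]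
    have key : ∀ x : τ.Domain M, (τ.formula φ).Realize (fun a => (v a).1)
        (Fin.snoc (α := fun _ => M) (fun i => (xs i).1) x.1) ↔
        φ.Realize v (Fin.snoc (α := fun _ => τ.Domain M) xs x) := fun x => by
      refine Iff.trans (iff_of_eq (congrArg _ (funext fun i => ?_))) (ih _)
      refine Fin.lastCases ?_ (fun i => ?_) i <;> simp
    exact ⟨fun h x => (key x).1 (h x.1 x.2), fun h x hx => (key ⟨x, hx⟩).2 (h ⟨x, hx⟩)⟩

end Translation

theorem Interpretable.mono {L : FirstOrder.Language.{u, v}} [L.IsRelational]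
    {L' : FirstOrder.Language.{u', v'}} {T : L.Theory} {U U' : L'.Theory} (h : Interpretable T U)
    (hU : U ⊆ U') : Interpretable T U' := by
  have key : ∀ φ : L'.Sentence, U ⊨ᵇ φ → U' ⊨ᵇ φ := fun φ hφ M v xs => by
    have : M ⊨ U := Theory.Model.mono M.is_model hU
    exact hφ (Theory.ModelType.of U M) v xs
  obtain ⟨τ, h1, h2⟩ := h
  exact ⟨τ, key _ h1, fun φ hφ => key _ (h2 φ hφ)⟩

/-! ### Uniform definability -/

section Realize

variable {M : Type} [seqLang.Structure M] {γ : Type}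

theorem realize_app (s t : seqLang.Term γ) (v : γ → M) :
    (app s t).realize v =
      Structure.funMap (L := seqLang) SeqFunc.app ![s.realize v, t.realize v] :=
  Term.realize_functions_apply₂

theorem realize_conc (s t : seqLang.Term γ) (v : γ → M) :
    (conc s t).realize v =
      Structure.funMap (L := seqLang) SeqFunc.conc ![s.realize v, t.realize v] :=
  Term.realize_functions_apply₂

theorem realize_empt (v : γ → M) :
    (empt : seqLang.Term γ).realize v = Structure.funMap (L := seqLang) SeqFunc.e ![] := by
  have := Term.realize_constants (L := seqLang) (c := SeqFunc.e) (v := v)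
  exact this.trans (congrArg (Structure.funMap (L := seqLang) SeqFunc.e) (Subsingleton.elim _ _))

end Realize

/-- The sequence algebra of a model of `Seq`. -/
instance modelAlg (M : Type) [seqLang.Structure M] [M ⊨ seqTheory] : SeqAlg M where
  nil := Structure.funMap (L := seqLang) SeqFunc.e ![]
  snoc x y := Structure.funMap (L := seqLang) SeqFunc.app ![x, y]
  cat x y := Structure.funMap (L := seqLang) SeqFunc.conc ![x, y]
  snoc_ne x y := by
    have h := seqTheory.realize_sentence_of_mem (M := M) (φ := seq1) (by simp [seqTheory])
    simp [seq1, Sentence.Realize, Formula.Realize, realize_app, realize_empt, Fin.snoc] at h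
    exact h x y
  snoc_inj x y z w := by
    have h := seqTheory.realize_sentence_of_mem (M := M) (φ := seq2) (by simp [seqTheory])
    simp [seq2, Sentence.Realize, Formula.Realize, realize_app, Fin.snoc] at h
    exact h x y z w
  cat_nil x := by
    have h := seqTheory.realize_sentence_of_mem (M := M) (φ := seq3) (by simp [seqTheory])
    simp [seq3, Sentence.Realize, Formula.Realize, realize_conc, realize_empt, Fin.snoc] at h
    exact h x
  cat_snoc x y z := by
    have h := seqTheory.realize_sentence_of_mem (M := M) (φ := seq4) (by simp [seqTheory])
    simp [seq4, Sentence.Realize, Formula.Realize, realize_app, realize_conc, Fin.snoc] at h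
    exact h x y z
  nil_or_snoc x := by
    have h := seqTheory.realize_sentence_of_mem (M := M) (φ := seq5) (by simp [seqTheory])
    simp [seq5, Sentence.Realize, Formula.Realize, realize_app, realize_empt, Fin.snoc] at h
    exact h x

/-- A sort that is definable uniformly in all models `M` of `Seq`: a type that `val` identifies with
the subset of `M` defined by the formula `dom`. -/
structure USort where
  carrier : ∀ (M : Type) [seqLang.Structure M] [M ⊨ seqTheory], Type
  val : ∀ (M : Type) [seqLang.Structure M] [M ⊨ seqTheory], carrier M → M
  inj : ∀ (M : Type) [seqLang.Structure M] [M ⊨ seqTheory], Function.Injective (val M)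
  dom : seqLang.Formula Unit
  dom_iff : ∀ (M : Type) [seqLang.Structure M] [M ⊨ seqTheory] (x : M),
    dom.Realize (fun _ => x) ↔ ∃ y, val M y = x

/-- Operations on a sort with arguments indexed by `α`, given in all models. -/
abbrev UFun (S : USort) (α : Type) : Type 1 :=
  ∀ (M : Type) [seqLang.Structure M] [M ⊨ seqTheory], (α → S.carrier M) → S.carrier M

/-- Relations on a sort with arguments indexed by `α`, given in all models. -/
abbrev URel (S : USort) (α : Type) : Type 1 :=
  ∀ (M : Type) [seqLang.Structure M] [M ⊨ seqTheory], (α → S.carrier M) → Prop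

/-- The operation `f` is given by the same term in all models. -/
def UTerm (S : USort) {α : Type} (f : UFun S α) : Prop :=
  ∃ t : seqLang.Term α, ∀ (M : Type) [seqLang.Structure M] [M ⊨ seqTheory] (v : α → S.carrier M),
    t.realize (fun a => S.val M (v a)) = S.val M (f M v)

/-- The relation `P` is defined by the same formula in all models. -/
def UDef (S : USort) {α : Type} (P : URel S α) : Prop :=
  ∃ φ : seqLang.Formula α, ∀ (M : Type) [seqLang.Structure M] [M ⊨ seqTheory]
    (v : α → S.carrier M), φ.Realize (fun a => S.val M (v a)) ↔ P M v

section UDef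

variable {S : USort} {α : Type}

theorem UTerm.var (a : α) : UTerm S fun _ _ _ v => v a := ⟨.var a, fun _ _ _ _ => rfl⟩

theorem UTerm.lift {f : UFun S α} (hf : UTerm S f) :
    UTerm S (α := Option α) fun M _ _ v => f M fun a => v (some a) := by
  obtain ⟨t, ht⟩ := hf
  refine ⟨t.relabel some, fun M _ _ v => ?_⟩
  rw [Term.realize_relabel, ← ht]
  rfl

theorem UDef.eq {f g : UFun S α} (hf : UTerm S f) (hg : UTerm S g) :
    UDef S fun M _ _ v => f M v = g M v := by
  obtain ⟨s, hs⟩ := hf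
  obtain ⟨t, ht⟩ := hg
  refine ⟨s.equal t, fun M _ _ v => ?_⟩
  rw [Formula.realize_equal, hs, ht]
  exact (S.inj M).eq_iff

theorem UDef.not {P : URel S α} (hP : UDef S P) : UDef S fun M _ _ v => ¬ P M v := by
  obtain ⟨φ, hφ⟩ := hP
  exact ⟨φ.not, fun M _ _ v => by rw [Formula.realize_not, hφ]⟩

theorem UDef.imp {P Q : URel S α} (hP : UDef S P) (hQ : UDef S Q) :
    UDef S fun M _ _ v => P M v → Q M v := by
  obtain ⟨φ, hφ⟩ := hP
  obtain ⟨ψ, hψ⟩ := hQ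
  exact ⟨φ.imp ψ, fun M _ _ v => by rw [Formula.realize_imp, hφ, hψ]⟩

theorem UDef.and {P Q : URel S α} (hP : UDef S P) (hQ : UDef S Q) :
    UDef S fun M _ _ v => P M v ∧ Q M v := by
  obtain ⟨φ, hφ⟩ := hP
  obtain ⟨ψ, hψ⟩ := hQ
  exact ⟨φ ⊓ ψ, fun M _ _ v => by rw [Formula.realize_inf, hφ, hψ]⟩

theorem UDef.or {P Q : URel S α} (hP : UDef S P) (hQ : UDef S Q) :
    UDef S fun M _ _ v => P M v ∨ Q M v := by
  obtain ⟨φ, hφ⟩ := hP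
  obtain ⟨ψ, hψ⟩ := hQ
  exact ⟨φ ⊔ ψ, fun M _ _ v => by rw [Formula.realize_sup, hφ, hψ]⟩

/-- In the scope of a quantifier the variables are indexed by `Option α`: `none` is the bound
variable. The formula relativizes the quantifier to the sort. -/
theorem UDef.all {P : ∀ (M : Type) [seqLang.Structure M] [M ⊨ seqTheory],
      (α → S.carrier M) → S.carrier M → Prop}
    (hP : UDef S (α := Option α) fun M _ _ v => P M (fun a => v (some a)) (v none)) :
    UDef S fun M _ _ v => ∀ x, P M v x := by
  obtain ⟨φ, hφ⟩ := hP
  let ψ : seqLang.Formula (Option α) := (S.dom.relabel fun _ => none).imp φ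
  let g : Option α → α ⊕ Fin 1 := fun o => o.elim (.inr 0) .inl
  let χ : seqLang.BoundedFormula α 1 := BoundedFormula.relabel (k := 0) g ψ
  have hχ : ∀ (M : Type) [seqLang.Structure M] (v : α → M) (x : M),
      χ.Realize v (Fin.snoc default x) ↔ ψ.Realize fun o => o.elim x v := fun M _ v x => by
    rw [realize_relabel_formula]
    refine iff_of_eq (congrArg _ (funext fun o => ?_))
    cases o <;> rfl
  refine ⟨χ.all, fun M _ _ v => ?_⟩
  refine BoundedFormula.realize_all.trans ?_
  have hφ' : ∀ y, φ.Realize (fun o : Option α => o.elim (S.val M y) fun a => S.val M (v a)) ↔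
      P M v y := fun y => by
    refine Iff.trans ?_ (hφ M fun o => o.elim y v)
    refine iff_of_eq (congrArg _ (funext fun o => ?_))
    cases o <;> rfl
  simp only [hχ, ψ, Formula.realize_imp, Formula.realize_relabel]
  constructor
  · exact fun h y => (hφ' y).1 (h (S.val M y) ((S.dom_iff M _).2 ⟨y, rfl⟩))
  · intro h x hx
    obtain ⟨y, rfl⟩ := (S.dom_iff M x).1 hx
    exact (hφ' y).2 (h y)

theorem UDef.congr {P Q : URel S α} (hP : UDef S P)
    (h : ∀ (M : Type) [seqLang.Structure M] [M ⊨ seqTheory] (v : α → S.carrier M),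
      P M v ↔ Q M v) : UDef S Q := by
  obtain ⟨φ, hφ⟩ := hP
  exact ⟨φ, fun M _ _ v => (hφ M v).trans (h M v)⟩

theorem UDef.ex {P : ∀ (M : Type) [seqLang.Structure M] [M ⊨ seqTheory],
      (α → S.carrier M) → S.carrier M → Prop}
    (hP : UDef S (α := Option α) fun M _ _ v => P M (fun a => v (some a)) (v none)) :
    UDef S fun M _ _ v => ∃ x, P M v x :=
  (UDef.not (UDef.all (P := fun M _ _ v x => ¬ P M v x) hP.not)).congr fun _ _ _ _ => not_forall_not

end UDef

/-! ### Definability of the cut -/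

/-- The sort of all elements of a model. -/
abbrev baseSort : USort where
  carrier M := M
  val _ := id
  inj _ _ _ := Function.injective_id
  dom := ⊤
  dom_iff _ _ _ x := by simp

instance (M : Type) [seqLang.Structure M] [M ⊨ seqTheory] : SeqAlg (baseSort.carrier M) :=
  modelAlg M

section Base

variable {α : Type} {f g : UFun baseSort α}

theorem UTerm.nil : UTerm baseSort (α := α) fun M _ _ _ => (SeqAlg.nil : baseSort.carrier M) :=
  ⟨empt, fun _ _ _ _ => realize_empt _⟩

theorem UTerm.snoc (hf : UTerm baseSort f) (hg : UTerm baseSort g) :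
    UTerm baseSort fun M _ _ v => SeqAlg.snoc (f M v) (g M v) := by
  obtain ⟨s, hs⟩ := hf
  obtain ⟨t, ht⟩ := hg
  refine ⟨app s t, fun M _ _ v => ?_⟩
  rw [realize_app, hs, ht]
  rfl

theorem UTerm.cat (hf : UTerm baseSort f) (hg : UTerm baseSort g) :
    UTerm baseSort fun M _ _ v => SeqAlg.cat (f M v) (g M v) := by
  obtain ⟨s, hs⟩ := hf
  obtain ⟨t, ht⟩ := hg
  refine ⟨conc s t, fun M _ _ v => ?_⟩
  rw [realize_conc, hs, ht]
  rfl

theorem UDef.regular (hf : UTerm baseSort f) :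
    UDef baseSort fun M _ _ v => SeqAlg.Regular (f M v) :=
  .and (.all (.all (.eq (.cat (.var _) (.cat (.var _) hf.lift.lift))
    (.cat (.cat (.var _) (.var _)) hf.lift.lift))))
    (.eq (.cat .nil hf) hf)

theorem UDef.refining (hf : UTerm baseSort f) :
    UDef baseSort fun M _ _ v => SeqAlg.Refining (f M v) :=
  .all (.all (.all (.imp (.eq (.cat (.var _) hf.lift.lift.lift) (.cat (.var _) (.var _)))
    (.ex (.or (.and (.eq (.var _) (.cat (.var _) (.var _)))
        (.eq (.cat (.var _) (.var _)) hf.lift.lift.lift.lift))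
      (.and (.eq (.var _) (.cat (.var _) (.var _)))
        (.eq (.cat (.var _) hf.lift.lift.lift.lift) (.var _))))))))

theorem UDef.hasFirst (hf : UTerm baseSort f) :
    UDef baseSort fun M _ _ v => SeqAlg.HasFirst (f M v) :=
  .or (.eq hf .nil) (.ex (.ex (.eq hf.lift.lift (.cat (.snoc .nil (.var _)) (.var _)))))

theorem UDef.acyclic (hf : UTerm baseSort f) :
    UDef baseSort fun M _ _ v => SeqAlg.Acyclic (f M v) :=
  .all (.imp (.regular (.var _)) (.imp (.eq (.cat hf.lift (.var _)) hf.lift) (.eq (.var _) .nil)))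

theorem UDef.tame (hf : UTerm baseSort f) :
    UDef baseSort fun M _ _ v => SeqAlg.Tame (f M v) :=
  .and (.regular hf) (.and (.refining hf) (.and (.hasFirst hf) (.acyclic hf)))

theorem UDef.absorbed (hf : UTerm baseSort f) :
    UDef baseSort fun M _ _ v => SeqAlg.Absorbed (f M v) :=
  .and (.tame hf) (.all (.imp (.tame (.var _)) (.tame (.cat (.var _) hf.lift))))

theorem UDef.cut (hf : UTerm baseSort f) :
    UDef baseSort fun M _ _ v => SeqAlg.Cut (f M v) :=
  .and (.absorbed hf) (.all (.all (.all
    (.imp (.eq hf.lift.lift.lift (.cat (.var _) (.cat (.var _) (.var _)))) (.absorbed (.var _))))))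

end Base

/-- The sort of the elements of the cut. -/
noncomputable abbrev cutSort : USort where
  carrier M := CutType M
  val _ := Subtype.val
  inj _ _ _ := Subtype.val_injective
  dom := (UDef.cut (f := fun _ _ _ v => v ()) (.var ())).choose
  dom_iff M _ _ x := by
    have := (UDef.cut (f := fun _ _ _ v => v ()) (.var ())).choose_spec M fun _ => x
    refine this.trans ?_
    exact ⟨fun h => ⟨⟨x, h⟩, rfl⟩, by rintro ⟨y, rfl⟩; exact y.2⟩

/-! ### Definability of the interpretation -/

noncomputable instance (M : Type) [seqLang.Structure M] [M ⊨ seqTheory] :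
    SeqMonoid (cutSort.carrier M) :=
  inferInstanceAs (SeqMonoid (CutType M))

section CutSort

variable {α : Type} {f g : UFun cutSort α}

theorem UTerm.one : UTerm cutSort (α := α) fun M _ _ _ => (1 : cutSort.carrier M) :=
  ⟨empt, fun _ _ _ _ => realize_empt _⟩

theorem UTerm.mul (hf : UTerm cutSort f) (hg : UTerm cutSort g) :
    UTerm cutSort fun M _ _ v => f M v * g M v := by
  obtain ⟨s, hs⟩ := hf
  obtain ⟨t, ht⟩ := hg
  refine ⟨conc s t, fun M _ _ v => ?_⟩
  rw [realize_conc, hs, ht]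
  rfl

theorem UTerm.sing (hf : UTerm cutSort f) :
    UTerm cutSort fun M _ _ v => SeqMonoid.sing (f M v) := by
  obtain ⟨s, hs⟩ := hf
  refine ⟨app empt s, fun M _ _ v => ?_⟩
  rw [realize_app, realize_empt, hs]
  rfl

theorem UDef.atom (hf : UTerm cutSort f) :
    UDef cutSort fun M _ _ v => Atom (f M v) :=
  .and (.not (.eq hf .one)) (.all (.all (.imp (.eq hf.lift.lift (.mul (.var _) (.var _)))
    (.or (.eq (.var _) .one) (.eq (.var _) .one)))))

theorem UDef.occ (hf : UTerm cutSort f) (hg : UTerm cutSort g) :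
    UDef cutSort fun M _ _ v => Occ (f M v) (g M v) :=
  .and (.atom hf) (.ex (.ex (.eq hg.lift.lift (.mul (.mul (.var _) hf.lift.lift) (.var _)))))

theorem UDef.comparable (hf : UTerm cutSort f) :
    UDef cutSort fun M _ _ v => Comparable (f M v) :=
  .all (.or (.ex (.eq (.var _) (.mul hf.lift.lift (.var _))))
    (.or (.ex (.eq hf.lift.lift (.mul (.var _) (.var _))))
      (.ex (.ex (.ex (.ex (.ex (.and (.atom (.var _)) (.and (.atom (.var _))
        (.and (.not (.eq (.var _) (.var _)))
          (.and (.eq hf.lift.lift.lift.lift.lift.lift (.mul (.mul (.var _) (.var _)) (.var _)))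
            (.eq (.var _) (.mul (.mul (.var _) (.var _)) (.var _))))))))))))))

theorem UDef.core
    {P : ∀ (M : Type) [seqLang.Structure M] [M ⊨ seqTheory], cutSort.carrier M → Prop}
    (hP : ∀ {β : Type} {e : UFun cutSort β}, UTerm cutSort e →
      UDef cutSort fun M _ _ v => P M (e M v))
    (hf : UTerm cutSort f) : UDef cutSort fun M _ _ v => Core (P M) (f M v) :=
  .all (.all (.all (.imp (.eq hf.lift.lift.lift (.mul (.mul (.var _) (.var _)) (.var _)))
    (.all (.imp (hP (.var _)) (hP (.mul (.var _) (.var _))))))))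

theorem UDef.lin (hf : UTerm cutSort f) : UDef cutSort fun M _ _ v => Lin (f M v) :=
  .core .comparable hf

theorem UDef.num (hf : UTerm cutSort f) : UDef cutSort fun M _ _ v => Num (f M v) :=
  .and (.lin hf) (.all (.imp (.occ (.var _) hf.lift) (.eq (.var _) (.sing .one))))

theorem UDef.letter (hf : UTerm cutSort f) : UDef cutSort fun M _ _ v => Letter (f M v) :=
  .ex (.and (.num (.var _)) (.eq hf.lift (.sing (.var _))))

theorem UDef.letterLt (hf : UTerm cutSort f) (hg : UTerm cutSort g) :
    UDef cutSort fun M _ _ v => LetterLt (f M v) (g M v) :=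
  .ex (.ex (.ex (.and (.num (.var _)) (.and (.num (.var _))
    (.and (.eq hf.lift.lift.lift (.sing (.var _))) (.and (.eq hg.lift.lift.lift (.sing (.var _)))
      (.and (.not (.eq (.var _) .one)) (.eq (.var _) (.mul (.var _) (.var _))))))))))

theorem UDef.letterLe (hf : UTerm cutSort f) (hg : UTerm cutSort g) :
    UDef cutSort fun M _ _ v => LetterLe (f M v) (g M v) :=
  .or (.eq hf hg) (.letterLt hf hg)

theorem UDef.allLt (hf : UTerm cutSort f) (hg : UTerm cutSort g) :
    UDef cutSort fun M _ _ v => AllLt (f M v) (g M v) :=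
  .all (.imp (.occ (.var _) hf.lift) (.letterLt (.var _) hg.lift))

theorem UDef.allLe (hf : UTerm cutSort f) (hg : UTerm cutSort g) :
    UDef cutSort fun M _ _ v => AllLe (f M v) (g M v) :=
  .all (.imp (.occ (.var _) hf.lift) (.letterLe (.var _) hg.lift))

theorem UDef.headGe (hf : UTerm cutSort f) (hg : UTerm cutSort g) :
    UDef cutSort fun M _ _ v => HeadGe (f M v) (g M v) :=
  .all (.all (.imp (.atom (.var _)) (.imp (.eq hf.lift.lift (.mul (.var _) (.var _)))
    (.letterLe hg.lift.lift (.var _)))))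

theorem UDef.isBlock (hf : UTerm cutSort f) (hg : UTerm cutSort g) :
    UDef cutSort fun M _ _ v => IsBlock (f M v) (g M v) :=
  .and (.letter hf) (.allLt hg hf)

theorem UDef.boundary (hf : UTerm cutSort f) (hg : UTerm cutSort g) :
    UDef cutSort fun M _ _ v => Boundary (f M v) (g M v) :=
  .all (.all (.imp (.atom (.var _)) (.imp (.eq hg.lift.lift (.mul (.var _) (.var _)))
    (.allLe hf.lift.lift (.var _)))))

theorem UDef.blockOf (hf : UTerm cutSort f) (hg : UTerm cutSort g) :
    UDef cutSort fun M _ _ v => BlockOf (f M v) (g M v) :=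
  .ex (.ex (.ex (.ex (.and (.eq hf.lift.lift.lift.lift (.mul (.var _) (.var _)))
    (.and (.eq hg.lift.lift.lift.lift (.mul (.mul (.var _) (.mul (.var _) (.var _))) (.var _)))
      (.and (.isBlock (.var _) (.var _)) (.and (.allLe (.var _) (.var _))
        (.headGe (.var _) (.var _)))))))))

theorem UDef.lex (hf : UTerm cutSort f) (hg : UTerm cutSort g) :
    UDef cutSort fun M _ _ v => Lex (f M v) (g M v) :=
  .or (.ex (.and (.not (.eq (.var _) .one)) (.eq hg.lift (.mul hf.lift (.var _)))))
    (.ex (.ex (.ex (.ex (.ex (.and (.letterLt (.var _) (.var _))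
      (.and (.eq hf.lift.lift.lift.lift.lift (.mul (.mul (.var _) (.var _)) (.var _)))
        (.eq hg.lift.lift.lift.lift.lift (.mul (.mul (.var _) (.var _)) (.var _))))))))))

theorem UDef.splits (hf : UTerm cutSort f) : UDef cutSort fun M _ _ v => Splits (f M v) :=
  .all (.imp (.letter (.var _)) (.ex (.ex (.and (.eq hf.lift.lift.lift (.mul (.var _) (.var _)))
    (.and (.allLt (.var _) (.var _)) (.headGe (.var _) (.var _)))))))

theorem UDef.hasLastBlock (hf : UTerm cutSort f) :
    UDef cutSort fun M _ _ v => HasLastBlock (f M v) :=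
  .or (.eq hf .one) (.ex (.ex (.ex
    (.and (.eq hf.lift.lift.lift (.mul (.var _) (.mul (.var _) (.var _))))
      (.and (.isBlock (.var _) (.var _)) (.allLe (.var _) (.var _)))))))

theorem UDef.hasPlace (hf : UTerm cutSort f) (hg : UTerm cutSort g) :
    UDef cutSort fun M _ _ v => HasPlace (f M v) (g M v) :=
  .ex (.ex (.and (.eq hf.lift.lift (.mul (.var _) (.var _)))
    (.and (.boundary (.var _) (.var _))
      (.and (.all (.imp (.blockOf (.var _) (.var _)) (.lex (.var _) hg.lift.lift.lift)))
        (.or (.eq (.var _) .one)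
          (.ex (.ex (.ex (.and (.eq (.var _) (.mul (.mul (.var _) (.var _)) (.var _)))
            (.and (.isBlock (.var _) (.var _)) (.and (.headGe (.var _) (.var _))
              (.not (.lex (.mul (.var _) (.var _)) hg.lift.lift.lift.lift.lift)))))))))))))

theorem UDef.wordLike (hf : UTerm cutSort f) : UDef cutSort fun M _ _ v => WordLike (f M v) :=
  .and (.lin hf) (.and (.all (.imp (.occ (.var _) hf.lift) (.letter (.var _))))
    (.and (.splits hf) (.and (.hasLastBlock hf) (.all (.hasPlace hf.lift (.var _))))))

theorem UDef.word (hf : UTerm cutSort f) : UDef cutSort fun M _ _ v => Word (f M v) :=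
  .core .wordLike hf

theorem UDef.sorted (hf : UTerm cutSort f) : UDef cutSort fun M _ _ v => Sorted (f M v) :=
  .all (.all (.imp (.eq hf.lift.lift (.mul (.var _) (.var _))) (.imp (.boundary (.var _) (.var _))
    (.all (.all (.imp (.blockOf (.var _) (.var _)) (.imp (.blockOf (.var _) (.var _))
      (.lex (.var _) (.var _)))))))))

theorem UDef.normal (hf : UTerm cutSort f) (hg : UTerm cutSort g) :
    UDef cutSort fun M _ _ v => Normal (f M v) (g M v) :=
  .and (.or (.eq hf (.sing .one)) (.ex (.and (.eq hf.lift (.sing (.mul (.var _) (.sing .one))))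
    (.occ (.sing (.var _)) hg.lift)))) (.sorted hg)

theorem UDef.hereditary (hf : UTerm cutSort f) : UDef cutSort fun M _ _ v => Hereditary (f M v) :=
  .all (.all (.all (.all (.imp
    (.eq hf.lift.lift.lift.lift (.mul (.mul (.var _) (.mul (.var _) (.var _))) (.var _)))
    (.imp (.isBlock (.var _) (.var _)) (.imp (.headGe (.var _) (.var _))
      (.normal (.var _) (.var _))))))))

theorem UDef.isSet (hf : UTerm cutSort f) : UDef cutSort fun M _ _ v => IsSet (f M v) :=
  .and (.word hf) (.and (.hereditary hf) (.ex (.ex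
    (.and (.eq hf.lift.lift (.mul (.var _) (.var _))) (.isBlock (.var _) (.var _))))))

theorem UDef.memSet (hf : UTerm cutSort f) (hg : UTerm cutSort g) :
    UDef cutSort fun M _ _ v => MemSet (f M v) (g M v) :=
  .ex (.ex (.and (.eq hg.lift.lift (.mul (.var _) (.var _)))
    (.and (.isBlock (.var _) (.var _)) (.blockOf hf.lift.lift (.var _)))))

end CutSort

/-! ### The interpretation -/

/-- The formula defining the domain, for elements of the cut. -/
noncomputable def isSetFormula : seqLang.Formula (Fin 1) :=
  (UDef.isSet (f := fun _ _ _ v => v 0) (.var 0)).choose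

/-- The formula defining membership, for elements of the cut: variable `0` is the element. -/
noncomputable def memSetFormula : seqLang.Formula (Fin 2) :=
  (UDef.memSet (f := fun _ _ _ v => v 0) (g := fun _ _ _ v => v 1) (.var 0) (.var 1)).choose

/-- The translation of the language of set theory. -/
noncomputable def astTranslation : Translation setLang seqLang where
  dom := cutSort.dom.relabel (fun _ => 0) ⊓ isSetFormula
  rel R := match R with
    | SetRel.mem => memSetFormula

section Model

variable {M : Type} [seqLang.Structure M] [M ⊨ seqTheory]

theorem realize_dom (x : M) :
    astTranslation.dom.Realize (fun _ => x) ↔ ∃ y : CutType M, IsSet y ∧ y.1 = x := by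
  have h : ∀ y : CutType M, isSetFormula.Realize (fun _ => y.1) ↔ IsSet y := fun y =>
    (UDef.isSet (f := fun _ _ _ v => v 0) (.var 0)).choose_spec M fun _ => y
  refine Formula.realize_inf.trans ?_
  rw [Formula.realize_relabel]
  constructor
  · rintro ⟨h1, h2⟩
    obtain ⟨y, rfl⟩ := (cutSort.dom_iff M x).1 h1
    exact ⟨y, (h y).1 h2, rfl⟩
  · rintro ⟨y, hy, rfl⟩
    exact ⟨(cutSort.dom_iff M _).2 ⟨y, rfl⟩, (h y).2 hy⟩

theorem relMap_mem {x y : astTranslation.Domain M} {a b : CutType M} (ha : a.1 = x.1)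
    (hb : b.1 = y.1) :
    Structure.RelMap (L := setLang) SetRel.mem ![x, y] ↔ MemSet a b := by
  have h := (UDef.memSet (f := fun _ _ _ v => v 0) (g := fun _ _ _ v => v 1)
    (.var 0) (.var 1)).choose_spec M ![a, b]
  refine Iff.trans (iff_of_eq (congrArg memSetFormula.Realize (funext fun i => ?_))) h
  fin_cases i
  · exact ha.symm
  · exact hb.symm

theorem exists_val (x : astTranslation.Domain M) : ∃ a : CutType M, IsSet a ∧ a.1 = x.1 :=
  (realize_dom x.1).1 x.2

theorem exists_domain {a : CutType M} (ha : IsSet a) : ∃ x : astTranslation.Domain M, a.1 = x.1 :=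
  ⟨⟨a.1, (realize_dom a.1).2 ⟨a, ha, rfl⟩⟩, rfl⟩

theorem realize_mem {N : Type} [setLang.Structure N] {n : ℕ} (s t : setLang.Term (Empty ⊕ Fin n))
    (v : Empty → N) (xs : Fin n → N) : (mem s t).Realize v xs ↔
      Structure.RelMap (L := setLang) SetRel.mem
        ![s.realize (Sum.elim v xs), t.realize (Sum.elim v xs)] :=
  BoundedFormula.realize_rel₂

theorem domain_models {φ : setLang.Sentence} (hφ : φ ∈ astExtTheory) :
    astTranslation.Domain M ⊨ φ := by
  simp only [astExtTheory, Set.mem_insert_iff, Set.mem_singleton_iff] at hφ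
  rcases hφ with rfl | rfl | rfl
  · simp [ast1, Sentence.Realize, Formula.Realize, realize_mem, Fin.snoc]
    obtain ⟨a, ha, h⟩ := exists_empty_set (W := CutType M)
    obtain ⟨x, hx⟩ := exists_domain ha
    refine ⟨x, fun y => ?_⟩
    obtain ⟨b, -, hb⟩ := exists_val y
    rw [relMap_mem hb hx]
    exact h b
  · simp [ast2, Sentence.Realize, Formula.Realize, realize_mem, Fin.snoc]
    intro x y
    obtain ⟨a, ha, hx⟩ := exists_val x
    obtain ⟨b, hb, hy⟩ := exists_val y
    obtain ⟨c, hc, h⟩ := exists_adjoin ha hb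
    obtain ⟨z, hz⟩ := exists_domain hc
    refine ⟨z, fun w => ?_⟩
    obtain ⟨d, -, hw⟩ := exists_val w
    rw [relMap_mem hw hz, relMap_mem hw hx, h, Subtype.ext_iff, hw, hy]
    exact or_congr Iff.rfl Subtype.ext_iff.symm
  · simp [ast3, Sentence.Realize, Formula.Realize, realize_mem, Fin.snoc]
    intro x y h
    obtain ⟨a, ha, hx⟩ := exists_val x
    obtain ⟨b, hb, hy⟩ := exists_val y
    apply Subtype.ext
    rw [← hx, ← hy]
    refine congrArg _ (ha.ext hb fun c hc => ?_)
    obtain ⟨z, hz⟩ := exists_domain hc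
    rw [← relMap_mem hz hx, ← relMap_mem hz hy]
    exact h z

end Model

theorem interpretable_seq : Interpretable astExtTheory seqTheory := by
  refine ⟨astTranslation, Theory.models_sentence_iff.2 fun M => ?_, fun φ hφ =>
    Theory.models_sentence_iff.2 fun M => ?_⟩
  · obtain ⟨a, ha, -⟩ := exists_empty_set (W := CutType M)
    refine BoundedFormula.realize_ex.2 ⟨a.1, ?_⟩
    rw [Translation.realize_domAt]
    exact (realize_dom a.1).2 ⟨a, ha, rfl⟩
  · have h := (astTranslation.realize_formula φ default default).2 (domain_models (M := M) hφ)
    have e : ∀ (v : Empty → M) (xs : Fin 0 → M),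
        (astTranslation.formula φ).Realize v xs ↔ M ⊨ astTranslation.formula φ := fun v xs => by
      rw [Subsingleton.elim v default, Subsingleton.elim xs default]
      rfl
    exact (e _ _).1 h

end SeqInterp

theorem mainTheorem1 :
    SeqInterp.Interpretable SeqInterp.astExtTheory SeqInterp.seqPlusTheory ∧
      SeqInterp.Interpretable SeqInterp.astExtTheory SeqInterp.seqTheory := by
  refine ⟨SeqInterp.interpretable_seq.mono fun φ hφ => ?_, SeqInterp.interpretable_seq⟩
  simp only [SeqInterp.seqTheory, SeqInterp.seqPlusTheory, Set.mem_insert_iff,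
    Set.mem_singleton_iff] at hφ ⊢
  tauto
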